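/- Let $0<\beta<2$ with $\beta\ne 1$. In the real Hilbert space $L^2(0,1)$ consider the operator $Av=-(x^\beta v')'$ whose domain $D(A)$ consists of all $v\in C[0,1]$, differentiable in $(0,1)$, such that $x^\beta v'\in C[0,1]$, $(x^\beta v')'\in AC[0,1]$ (hence $Av\in L^2(0,1)$), $v(1)=0$ and, if $\beta<1$, also $v(0)=0$. Let $A_F$ be the Friedrichs extension of $A$, that is, the restriction of the adjoint $A^*$ to those $u\in D(A^*)$ for which there are $u_n\in D(A)$ with $u_n\to u$ in $L^2(0,1)$ and $(A(u_n-u_m),u_n-u_m)\to 0$ as $n,m\to\infty$. Then $A_F$ has a discrete spectrum: its spectrum consists of eigenvalues of finite multiplicity and has no finite accumulation point. Moreover, there are a sequence $(\lambda_n)$ of positive numbers with $\lambda_n\to\infty$, whose set of values is the spectrum of $A_F$, and functions $v_n\in D(A)$ such that: 1. $(v_n)$ is a complete orthonormal system in $L^2(0,1)$; 2. $v_n\in D(A_F)$ and $A_Fv_n=\lambda_n v_n$; in fact $-(x^\beta v_n')'=\lambda_n v_n$ holds pointwise in $(0,1)$; 3. $(v_n)$ is orthogonal in the energy space: for all $i,j$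 the function $x^\beta v_i'v_j'$ is integrable on $(0,1)$ and $$\int_0^1 x^\beta v_i'(x)\,v_j'(x)\,dx=\begin{cases}\lambda_i,& i=j,\\ 0,& i\ne j.\end{cases}$$ -/

import Mathlib

open Set Filter Topology MeasureTheory

noncomputable section

/-! ## Unbounded operators on a Hilbert space: spectrum and Friedrichs extension -/

namespace LinearPMap

section Spectrum

variable {𝕜 E : Type*} [RCLike 𝕜] [NormedAddCommGroup E] [InnerProductSpace 𝕜 E]

/-- The linear map `x ↦ T x - μ x` from the domain of `T` to `E`. -/
def shift (T : E →ₗ.[𝕜] E) (μ : 𝕜) : T.domain →ₗ[𝕜] E :=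
  T.toFun - μ • T.domain.subtype

/-- `μ` is in the resolvent set of `T` if `T - μ` maps the domain of `T` bijectively onto `E`, with
bounded inverse. -/
def resolventSet (T : E →ₗ.[𝕜] E) : Set 𝕜 :=
  {μ | Function.Bijective (T.shift μ) ∧ ∃ C : ℝ, ∀ x : T.domain, ‖(x : E)‖ ≤ C * ‖T.shift μ x‖}

/-- The spectrum of `T`. -/
def spectrum (T : E →ₗ.[𝕜] E) : Set 𝕜 := T.resolventSetᶜ

/-- The space of all `x` in the domain of `T` with `T x = μ x`. -/
def eigenspace (T : E →ₗ.[𝕜] E) (μ : 𝕜) : Submodule 𝕜 E :=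
  (LinearMap.ker (T.shift μ)).map T.domain.subtype

/-- The spectrum of `T` is discrete: it consists of eigenvalues of finite multiplicity and has no
(finite) accumulation point. -/
structure HasDiscreteSpectrum (T : E →ₗ.[𝕜] E) : Prop where
  eigenspace_ne_bot : ∀ μ ∈ T.spectrum, T.eigenspace μ ≠ ⊥
  finiteDimensional : ∀ μ ∈ T.spectrum, FiniteDimensional 𝕜 (T.eigenspace μ)
  not_accPt : ∀ μ : 𝕜, ¬ AccPt μ (𝓟 T.spectrum)

end Spectrum

section Friedrichs

variable {𝕜 E : Type*} [RCLike 𝕜] [NormedAddCommGroup E] [InnerProductSpace 𝕜 E]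

/-- The quadratic form `⟨T x, x⟩` on the domain of `T`. -/
def energy (T : E →ₗ.[𝕜] E) (x : T.domain) : ℝ := RCLike.re (inner 𝕜 (T x) (x : E))

theorem energy_add_sub (T : E →ₗ.[𝕜] E) (x y : T.domain) :
    T.energy (x + y) + T.energy (x - y) = 2 * T.energy x + 2 * T.energy y := by
  simp only [energy, LinearPMap.map_add, LinearPMap.map_sub, Submodule.coe_add,
    Submodule.coe_sub, inner_add_left, inner_add_right, inner_sub_left, inner_sub_right,
    _root_.map_add, _root_.map_sub]
  ring

theorem energy_smul (T : E →ₗ.[𝕜] E) (c : 𝕜) (x : T.domain) :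
    T.energy (c • x) = ‖c‖ ^ 2 * T.energy x := by
  have h : inner 𝕜 (T (c • x)) ((c • x : T.domain) : E)
      = ((‖c‖ ^ 2 : ℝ) : 𝕜) * inner 𝕜 (T x) (x : E) := by
    rw [LinearPMap.map_smul, Submodule.coe_smul, inner_smul_left, inner_smul_right, ← mul_assoc,
      RCLike.conj_mul]
    push_cast
    rfl
  rw [energy, h, RCLike.re_ofReal_mul, energy]

/-- The energy space of a symmetric positive operator `T`, as a subspace of `E` (the domain of the closure of
the quadratic form of `T`): all limits in `E` of sequences in the domain of `T` that are Cauchy with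
respect to the quadratic form of `T`. -/
def energySpace (T : E →ₗ.[𝕜] E) (hT : ∀ x : T.domain, 0 ≤ T.energy x) : Submodule 𝕜 E where
  carrier := {f | ∃ u : ℕ → T.domain, Tendsto (fun n => (u n : E)) atTop (𝓝 f) ∧
    Tendsto (fun p : ℕ × ℕ => T.energy (u p.1 - u p.2)) atTop (𝓝 0)}
  zero_mem' := ⟨fun _ => 0, by simp, by simp [energy]⟩
  add_mem' := by
    rintro f g ⟨u, hu, hu'⟩ ⟨v, hv, hv'⟩
    refine ⟨fun n => u n + v n, by simpa using hu.add hv, ?_⟩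
    have h := (hu'.const_mul 2).add (hv'.const_mul 2)
    simp only [mul_zero, add_zero] at h
    refine squeeze_zero (fun p => hT _) (fun p => ?_) h
    have e : u p.1 + v p.1 - (u p.2 + v p.2) = (u p.1 - u p.2) + (v p.1 - v p.2) := by abel
    rw [e, ← energy_add_sub]
    exact le_add_of_nonneg_right (hT _)
  smul_mem' := by
    rintro c f ⟨u, hu, hu'⟩
    refine ⟨fun n => c • u n, by simpa using hu.const_smul c, ?_⟩
    have h := hu'.const_mul (‖c‖ ^ 2)
    simpa only [mul_zero, ← energy_smul, smul_sub] using h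

/-- The Friedrichs extension of a densely defined, symmetric, positive operator `T`: the restriction of the
adjoint of `T` to the intersection of its domain with the energy space of `T`. -/
def friedrichsExtension [CompleteSpace E] (T : E →ₗ.[𝕜] E)
    (hT : ∀ x : T.domain, 0 ≤ T.energy x) : E →ₗ.[𝕜] E :=
  T.adjoint.domRestrict (T.energySpace hT)

end Friedrichs

end LinearPMap

/-! ## The degenerate operator `A v = -(x ^ β v')'` on the interval `(0, 1)` -/

namespace Degenerate

/-- The real Hilbert space `L²(0, 1)`. -/
abbrev L2 : Type := Lp ℝ 2 (volume.restrict (Ioo (0 : ℝ) 1))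

/-- The flux `x ^ β v'(x)`. -/
def flux (β : ℝ) (v : ℝ → ℝ) (x : ℝ) : ℝ := x ^ β * deriv v x

/-- The differential expression `A v = -(x ^ β v')'`. -/
def diffExpr (β : ℝ) (v : ℝ → ℝ) (x : ℝ) : ℝ := -deriv (flux β v) x

/-- The domain `D(A)`: `v` is continuous on `[0, 1]` and differentiable in `(0, 1)`, the flux
`x ^ β v'` extends continuously to `[0, 1]`, its derivative is absolutely continuous on `[0, 1]`
(so that `A v` is in `L²(0, 1)`), `v(1) = 0` and, if `β < 1`, also `v(0) = 0`. -/
structure InDomain (β : ℝ) (v : ℝ → ℝ) : Prop where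
  continuousOn : ContinuousOn v (Icc 0 1)
  differentiableAt : ∀ x ∈ Ioo (0 : ℝ) 1, DifferentiableAt ℝ v x
  flux_continuous : ∃ w : ℝ → ℝ, ContinuousOn w (Icc 0 1) ∧ EqOn w (flux β v) (Ioo 0 1)
  deriv_flux : ∃ g : ℝ → ℝ, AbsolutelyContinuousOnInterval g 0 1 ∧
    ∀ x ∈ Ioo (0 : ℝ) 1, HasDerivAt (flux β v) (g x) x
  right_boundary : v 1 = 0
  left_boundary : β < 1 → v 0 = 0

theorem flux_add {β : ℝ} {v₁ v₂ : ℝ → ℝ} {x : ℝ} (h₁ : DifferentiableAt ℝ v₁ x)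
    (h₂ : DifferentiableAt ℝ v₂ x) : flux β (v₁ + v₂) x = flux β v₁ x + flux β v₂ x := by
  simp only [flux, deriv_add h₁ h₂]; ring

theorem flux_smul {β : ℝ} {v : ℝ → ℝ} {x : ℝ} (c : ℝ) :
    flux β (c • v) x = c * flux β v x := by
  simp only [flux, deriv_const_smul_field c v, smul_eq_mul]; ring

namespace InDomain

variable {β : ℝ} {v v₁ v₂ : ℝ → ℝ}

theorem add_flux_eventuallyEq (h₁ : InDomain β v₁) (h₂ : InDomain β v₂) {x : ℝ}
    (hx : x ∈ Ioo (0 : ℝ) 1) : flux β (v₁ + v₂) =ᶠ[𝓝 x] flux β v₁ + flux β v₂ := by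
  filter_upwards [Ioo_mem_nhds hx.1 hx.2] with y hy
  exact flux_add (h₁.differentiableAt y hy) (h₂.differentiableAt y hy)

theorem zero : InDomain β (0 : ℝ → ℝ) := by
  have h : flux β (0 : ℝ → ℝ) = 0 := by
    ext x
    simpa using flux_smul (β := β) (v := 0) (x := x) 0
  refine ⟨continuousOn_const, fun x _ => differentiableAt_const (0 : ℝ),
    ⟨0, continuousOn_const, ?_⟩, ⟨fun _ => 0, ?_, ?_⟩, rfl, fun _ => rfl⟩
  · rw [h]; exact fun _ _ => rfl
  · exact contDiffOn_const.absolutelyContinuousOnInterval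
  · intro x _; rw [h]; exact hasDerivAt_const x (0 : ℝ)

theorem add (h₁ : InDomain β v₁) (h₂ : InDomain β v₂) : InDomain β (v₁ + v₂) := by
  obtain ⟨w₁, hw₁, hf₁⟩ := h₁.flux_continuous
  obtain ⟨w₂, hw₂, hf₂⟩ := h₂.flux_continuous
  obtain ⟨g₁, hg₁, hd₁⟩ := h₁.deriv_flux
  obtain ⟨g₂, hg₂, hd₂⟩ := h₂.deriv_flux
  refine ⟨h₁.continuousOn.add h₂.continuousOn,
    fun x hx => (h₁.differentiableAt x hx).add (h₂.differentiableAt x hx),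
    ⟨w₁ + w₂, hw₁.add hw₂, fun x hx => ?_⟩, ⟨g₁ + g₂, hg₁.add hg₂, fun x hx => ?_⟩, ?_,
    fun hβ => ?_⟩
  · rw [flux_add (h₁.differentiableAt x hx) (h₂.differentiableAt x hx), Pi.add_apply, hf₁ hx,
      hf₂ hx]
  · exact ((hd₁ x hx).add (hd₂ x hx)).congr_of_eventuallyEq (h₁.add_flux_eventuallyEq h₂ hx)
  · simp [h₁.right_boundary, h₂.right_boundary]
  · simp [h₁.left_boundary hβ, h₂.left_boundary hβ]

theorem smul (h : InDomain β v) (c : ℝ) : InDomain β (c • v) := by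
  obtain ⟨w, hw, hf⟩ := h.flux_continuous
  obtain ⟨g, hg, hd⟩ := h.deriv_flux
  have e : flux β (c • v) = fun x => c * flux β v x := funext fun x => flux_smul c
  refine ⟨h.continuousOn.const_smul c, fun x hx => (h.differentiableAt x hx).const_smul c,
    ⟨fun x => c * w x, hw.const_mul c, fun x hx => ?_⟩,
    ⟨fun x => c * g x, hg.const_mul c, fun x hx => ?_⟩, ?_, fun hβ => ?_⟩
  · simp only [e, hf hx]
  · rw [e]; exact (hd x hx).const_mul c
  · simp [h.right_boundary]
  · simp [h.left_boundary hβ]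

theorem diffExpr_add (h₁ : InDomain β v₁) (h₂ : InDomain β v₂) {x : ℝ}
    (hx : x ∈ Ioo (0 : ℝ) 1) :
    diffExpr β (v₁ + v₂) x = diffExpr β v₁ x + diffExpr β v₂ x := by
  obtain ⟨g₁, -, hd₁⟩ := h₁.deriv_flux
  obtain ⟨g₂, -, hd₂⟩ := h₂.deriv_flux
  rw [diffExpr, (h₁.add_flux_eventuallyEq h₂ hx).deriv_eq,
    ((hd₁ x hx).add (hd₂ x hx)).deriv, diffExpr, diffExpr, (hd₁ x hx).deriv, (hd₂ x hx).deriv]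
  ring

theorem diffExpr_smul (h : InDomain β v) (c : ℝ) {x : ℝ} (hx : x ∈ Ioo (0 : ℝ) 1) :
    diffExpr β (c • v) x = c * diffExpr β v x := by
  obtain ⟨g, -, hd⟩ := h.deriv_flux
  have e : flux β (c • v) = fun x => c * flux β v x := funext fun x => flux_smul c
  rw [diffExpr, e, ((hd x hx).const_mul c).deriv, diffExpr, (hd x hx).deriv]
  ring

end InDomain

/-- The graph of the operator `A` with domain `D(A)`, as a subspace of `L²(0, 1) × L²(0, 1)`. -/
def graph (β : ℝ) : Submodule ℝ (L2 × L2) where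
  carrier := {p | ∃ v : ℝ → ℝ, InDomain β v ∧ p.1 =ᵐ[volume.restrict (Ioo (0 : ℝ) 1)] v ∧
    p.2 =ᵐ[volume.restrict (Ioo (0 : ℝ) 1)] diffExpr β v}
  zero_mem' := by
    refine ⟨0, InDomain.zero, Lp.coeFn_zero _ _ _, (Lp.coeFn_zero _ _ _).trans ?_⟩
    filter_upwards [ae_restrict_mem measurableSet_Ioo] with x hx
    have := (InDomain.zero (β := β)).diffExpr_smul 0 hx
    rw [smul_zero, zero_mul] at this
    rw [this, Pi.zero_apply]
  add_mem' := by
    rintro p q ⟨v, hv, hp₁, hp₂⟩ ⟨u, hu, hq₁, hq₂⟩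
    refine ⟨v + u, hv.add hu, (Lp.coeFn_add _ _).trans (hp₁.add hq₁), ?_⟩
    filter_upwards [Lp.coeFn_add p.2 q.2, hp₂, hq₂, ae_restrict_mem measurableSet_Ioo]
      with x h h₁ h₂ hx
    rw [Prod.snd_add, h, Pi.add_apply, h₁, h₂, hv.diffExpr_add hu hx]
  smul_mem' := by
    rintro c p ⟨v, hv, hp₁, hp₂⟩
    refine ⟨c • v, hv.smul c, (Lp.coeFn_smul _ _).trans (hp₁.const_smul c), ?_⟩
    filter_upwards [Lp.coeFn_smul c p.2, hp₂, ae_restrict_mem measurableSet_Ioo] with x h h₁ hx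
    rw [Prod.smul_snd, h, Pi.smul_apply, h₁, hv.diffExpr_smul c hx, smul_eq_mul]

theorem graph_singleValued (β : ℝ) (p : L2 × L2) (hp : p ∈ graph β) (h0 : p.1 = 0) :
    p.2 = 0 := by
  obtain ⟨v, hv, h₁, h₂⟩ := hp
  have hv0 : EqOn v 0 (Ioo 0 1) := by
    refine Measure.eqOn_Ioo_of_ae_eq (μ := volume) ?_ (hv.continuousOn.mono Ioo_subset_Icc_self)
      continuousOn_const
    rw [h0] at h₁
    exact h₁.symm.trans (Lp.coeFn_zero _ _ _)
  have hf : EqOn (flux β v) (fun _ => 0) (Ioo 0 1) := by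
    intro x hx
    have : v =ᶠ[𝓝 x] fun _ => 0 := by
      filter_upwards [Ioo_mem_nhds hx.1 hx.2] with y hy using hv0 hy
    simp [flux, this.deriv_eq]
  refine Lp.ext (h₂.trans (EventuallyEq.trans ?_ (Lp.coeFn_zero _ _ _).symm))
  filter_upwards [ae_restrict_mem measurableSet_Ioo] with x hx
  have : flux β v =ᶠ[𝓝 x] fun _ => 0 := by
    filter_upwards [Ioo_mem_nhds hx.1 hx.2] with y hy using hf hy
  simp [diffExpr, this.deriv_eq]

/-- The operator `A v = -(x ^ β v')'` in `L²(0, 1)` with domain `D(A)`. -/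
def operator (β : ℝ) : L2 →ₗ.[ℝ] L2 := (graph β).toLinearPMap

theorem operator_graph (β : ℝ) : (operator β).graph = graph β :=
  Submodule.toLinearPMap_graph_eq _ (graph_singleValued β)

/-- If `β ≥ 1`, a function that is bounded near `0` has no positive flux at `0`. -/
theorem flux_zero_le {β : ℝ} (hβ : 1 ≤ β) {v w : ℝ → ℝ} (hv : ContinuousOn v (Icc 0 1))
    (hd : ∀ x ∈ Ioo (0 : ℝ) 1, DifferentiableAt ℝ v x) (hw : ContinuousOn w (Icc 0 1))
    (hf : EqOn w (flux β v) (Ioo 0 1)) : w 0 ≤ 0 := by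
  by_contra! hb
  set c := w 0 / 2 with hc
  have hcpos : 0 < c := by positivity
  have h0 : (0 : ℝ) ∈ Icc (0 : ℝ) 1 := ⟨le_rfl, zero_le_one⟩
  have hev : ∀ᶠ x in 𝓝[Icc 0 1] (0 : ℝ), c < w x :=
    (hw 0 h0).eventually (lt_mem_nhds (by linarith))
  obtain ⟨δ, hδ, hball⟩ := Metric.mem_nhdsWithin_iff.1 hev
  set a := min (δ / 2) (1 / 2) with ha
  have ha0 : 0 < a := by positivity
  have haδ : a ≤ δ / 2 := min_le_left _ _
  have ha1 : a ≤ 1 / 2 := min_le_right _ _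
  have hmono : MonotoneOn (fun x => v x - c * Real.log x) (Ioc 0 a) := by
    apply monotoneOn_of_deriv_nonneg (convex_Ioc 0 a)
    · refine (hv.mono fun x hx => ⟨hx.1.le, by linarith [hx.2]⟩).sub
        (ContinuousOn.const_mul (Real.continuousOn_log.mono fun x hx => ?_) c)
      exact ne_of_gt hx.1
    · rw [interior_Ioc]
      intro x hx
      exact ((hd x ⟨hx.1, by linarith [hx.2]⟩).sub
        ((Real.differentiableAt_log hx.1.ne').const_mul c)).differentiableWithinAt
    · rw [interior_Ioc]
      intro x hx
      have hx01 : x ∈ Ioo (0 : ℝ) 1 := ⟨hx.1, by linarith [hx.2]⟩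
      have hder : HasDerivAt (fun x => v x - c * Real.log x) (deriv v x - c * x⁻¹) x :=
        (hd x hx01).hasDerivAt.sub ((Real.hasDerivAt_log hx.1.ne').const_mul c)
      rw [hder.deriv]
      have hwx : c < w x := hball
        ⟨by rw [Metric.mem_ball, Real.dist_eq, sub_zero, abs_of_pos hx.1]; linarith [hx.2],
          hx.1.le, hx01.2.le⟩
      rw [hf hx01, flux] at hwx
      have hxb : 0 < x ^ β := Real.rpow_pos_of_pos hx.1 β
      have hle : x ^ β ≤ x := by
        simpa using Real.rpow_le_rpow_of_exponent_ge hx.1 hx01.2.le hβ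
      have hdv : 0 < deriv v x := by
        by_contra! hn
        nlinarith
      have : c ≤ x * deriv v x := by nlinarith
      rw [sub_nonneg, ← div_eq_mul_inv, div_le_iff₀ hx.1]
      linarith
  have hlim : Tendsto (fun x => v a - c * Real.log a + c * Real.log x) (𝓝[>] 0) atBot :=
    tendsto_atBot_add_const_left _ _
      (Real.tendsto_log_nhdsGT_zero.const_mul_atBot hcpos)
  have hvlim : Tendsto v (𝓝[>] 0) (𝓝 (v 0)) :=
    ((hv 0 h0).mono_of_mem_nhdsWithin (Icc_mem_nhdsGT zero_lt_one))
  have hbot : Tendsto v (𝓝[>] 0) atBot := by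
    refine tendsto_atBot_mono' _ ?_ hlim
    filter_upwards [Ioc_mem_nhdsGT ha0] with x hx
    have := hmono hx (right_mem_Ioc.2 ha0) hx.2
    simp only at this
    linarith
  exact not_tendsto_nhds_of_tendsto_atBot hbot _ hvlim

/-- The boundary term `v x ^ β v'` vanishes at `0` for every `v ∈ D(A)`. -/
theorem InDomain.flux_mul_zero {β : ℝ} {v w : ℝ → ℝ} (h : InDomain β v)
    (hw : ContinuousOn w (Icc 0 1)) (hf : EqOn w (flux β v) (Ioo 0 1)) : w 0 * v 0 = 0 := by
  rcases lt_or_ge β 1 with hβ | hβ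
  · rw [h.left_boundary hβ, mul_zero]
  · have h1 := flux_zero_le hβ h.continuousOn h.differentiableAt hw hf
    have h2 : (fun x => -w x) 0 ≤ 0 := by
      have hn := h.smul (-1)
      refine flux_zero_le hβ hn.continuousOn hn.differentiableAt hw.neg fun x hx => ?_
      rw [flux_smul, ← hf hx, Pi.neg_apply]
      ring
    have : w 0 = 0 := le_antisymm h1 (by simpa using h2)
    rw [this, zero_mul]

/-- The operator `A` is positive, so that its Friedrichs extension is defined. -/
theorem operator_energy_nonneg (β : ℝ) (f : (operator β).domain) : 0 ≤ (operator β).energy f := by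
  have hmem : ((f : L2), operator β f) ∈ graph β := by
    rw [← operator_graph]; exact LinearPMap.mem_graph _ f
  obtain ⟨v, hv, h₁, h₂⟩ := hmem
  obtain ⟨w, hw, hf⟩ := hv.flux_continuous
  obtain ⟨g, hg, hd⟩ := hv.deriv_flux
  have hgc : ContinuousOn g (Icc 0 1) := by
    have := hg.continuousOn
    rwa [uIcc_of_le zero_le_one] at this
  have hvg : ContinuousOn (fun x => g x * v x) (uIcc 0 1) := by
    rw [uIcc_of_le zero_le_one]; exact hgc.mul hv.continuousOn
  have hE : (operator β).energy f = -∫ x in (0 : ℝ)..1, g x * v x := by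
    rw [LinearPMap.energy, L2.inner_def, RCLike.re_to_real, intervalIntegral.integral_of_le
      zero_le_one, integral_Ioc_eq_integral_Ioo, ← integral_neg]
    refine integral_congr_ae ?_
    filter_upwards [h₁, h₂, ae_restrict_mem measurableSet_Ioo] with x hx₁ hx₂ hx
    rw [hx₁, hx₂, diffExpr, (hd x hx).deriv]
    simp [mul_comm]
  have hmono : MonotoneOn (fun x => w x * v x - ∫ t in (0 : ℝ)..x, g t * v t) (Icc 0 1) := by
    have hder : ∀ x ∈ Ioo (0 : ℝ) 1, HasDerivAt
        (fun x => w x * v x - ∫ t in (0 : ℝ)..x, g t * v t) (w x * deriv v x) x := by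
      intro x hx
      have hwd : HasDerivAt w (g x) x := by
        refine (hd x hx).congr_of_eventuallyEq ?_
        filter_upwards [Ioo_mem_nhds hx.1 hx.2] with y hy using hf hy
      have hnhds : Icc (0 : ℝ) 1 ∈ 𝓝 x := Icc_mem_nhds hx.1 hx.2
      rw [uIcc_of_le zero_le_one] at hvg
      have hI : HasDerivAt (fun x => ∫ t in (0 : ℝ)..x, g t * v t) (g x * v x) x := by
        refine intervalIntegral.integral_hasDerivAt_right ?_ ?_ (hvg.continuousAt hnhds)
        · refine (hvg.mono ?_).intervalIntegrable
          rw [uIcc_of_le hx.1.le]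
          exact Icc_subset_Icc_right hx.2.le
        · exact (hvg.mono Ioo_subset_Icc_self).stronglyMeasurableAtFilter isOpen_Ioo x hx
      have := (hwd.mul (hv.differentiableAt x hx).hasDerivAt).sub hI
      exact this.congr_deriv (by ring)
    apply monotoneOn_of_deriv_nonneg (convex_Icc 0 1)
    · refine (hw.mul hv.continuousOn).sub ?_
      have := intervalIntegral.continuousOn_primitive_interval (μ := volume)
        (hvg.integrableOn_compact isCompact_uIcc)
      rwa [uIcc_of_le zero_le_one] at this
    · rw [interior_Icc]
      exact fun x hx => (hder x hx).differentiableAt.differentiableWithinAt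
    · rw [interior_Icc]
      intro x hx
      rw [(hder x hx).deriv, hf hx, flux, mul_assoc]
      exact mul_nonneg (Real.rpow_nonneg hx.1.le β) (mul_self_nonneg _)
  have h01 := hmono (left_mem_Icc.2 zero_le_one) (right_mem_Icc.2 zero_le_one) zero_le_one
  simp only [intervalIntegral.integral_same, sub_zero, hv.right_boundary, mul_zero,
    hv.flux_mul_zero hw hf, zero_sub] at h01
  rwa [hE]

/-- The Friedrichs extension of the operator `A`. -/
def friedrichs (β : ℝ) : L2 →ₗ.[ℝ] L2 :=
  (operator β).friedrichsExtension (operator_energy_nonneg β)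

end Degenerate

end

/-! The boundary value problem has an explicit solution operator K. With q = `potential β`, the
solution of -(x^β u')' = f is the integral of f against Green's function q(max x y), corrected for β
< 1 by a rank-one term that enforces u(0) = 0. Put e = max 0 (β - 1), which is less than 1 because β
< 2. The kernel is bounded by a constant times x^(-a) y^(-b) for all a, b ≥ 0 with a + b = e
(`abs_green_le`). The even split a = b = e/2 dominates it by h(x) h(y) with h in L², so K is
symmetric and Hilbert–Schmidt.

K is a left inverse of A by uniqueness for the homogeneous problem (`InDomain.eqOn_greenFun`), and a
right inverse on test functions, which are dense. These two facts alone force K to be the inverse of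
the Friedrichs extension (`isBoundedInverse_friedrichsExtension`). Since K is compact, symmetric,
injective and positive, its eigenvectors form a Hilbert basis, and the reciprocals of its
eigenvalues are exactly the spectrum of the extension (`IsBoundedInverse.hasDiscreteSpectrum`).

An eigenvector is at first only an L² class. The equation v = λ K v lowers its growth exponent at 0
step by step until v is bounded, hence continuous, hence absolutely continuous, hence in D(A).
Orthogonality in the energy space is then integration by parts, all boundary terms being zero. -/

noncomputable section

/-! ## Hilbert–Schmidt operators -/

namespace ContinuousLinearMap

universe u

variable {E : Type u} {F : Type*} [NormedAddCommGroup E] [InnerProductSpace ℝ E]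
  [NormedAddCommGroup F] [InnerProductSpace ℝ F]

/-- A bounded operator is Hilbert–Schmidt if the sums of `‖K x‖ ^ 2` over finite orthonormal sets
are bounded. -/
def IsHilbertSchmidt (K : E →L[ℝ] F) : Prop :=
  ∃ C : ℝ, ∀ s : Finset E, Orthonormal ℝ (Subtype.val : ↥(s : Set E) → E) → ∑ x ∈ s, ‖K x‖ ^ 2 ≤ C

theorem IsHilbertSchmidt.summable {K : E →L[ℝ] F} (hK : K.IsHilbertSchmidt) {ι : Type*} {b : ι → E}
    (hb : Orthonormal ℝ b) : Summable fun i => ‖K (b i)‖ ^ 2 := by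
  classical
  obtain ⟨C, hC⟩ := hK
  refine summable_of_sum_le (c := C) (fun i => by positivity) fun u => ?_
  have hinj : Function.Injective b := hb.linearIndependent.injective
  have := hC (u.map ⟨b, hinj⟩) <| by
    rw [orthonormal_subtype_iff_ite]
    simp only [Finset.coe_map, Function.Embedding.coeFn_mk, mem_image, forall_exists_index, and_imp,
      forall_apply_eq_imp_iff₂]
    intro i _ j _
    simp [orthonormal_iff_ite.1 hb i j, hinj.eq_iff]
  simpa using this

theorem orthonormal_insert {s : Set E} (hs : Orthonormal ℝ (Subtype.val : ↥s → E)) {e : E}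
    (he : ‖e‖ = 1) (hes : ∀ x ∈ s, inner ℝ e x = 0) :
    Orthonormal ℝ (Subtype.val : ↥(insert e s : Set E) → E) := by
  classical
  rw [orthonormal_subtype_iff_ite] at hs ⊢
  have hne : ∀ x ∈ s, e ≠ x := by
    rintro x hx rfl
    have := hes e hx
    rw [real_inner_self_eq_norm_sq, he] at this
    norm_num at this
  rintro v (rfl | hv) w (rfl | hw)
  · simp [he]
  · simp [hes w hw, hne w hw]
  · rw [real_inner_comm, hes v hv, if_neg (hne v hv).symm]
  · exact hs v hv w hw

/-- Up to `ε`, a Hilbert–Schmidt operator lives on a finite-dimensional subspace. -/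
theorem IsHilbertSchmidt.exists_finset {K : E →L[ℝ] F} (hK : K.IsHilbertSchmidt) {ε : ℝ}
    (hε : 0 < ε) : ∃ s : Finset E, ∀ h : E, (∀ x ∈ s, inner ℝ h x = 0) → ‖K h‖ ≤ ε * ‖h‖ := by
  classical
  obtain ⟨C, hC⟩ := hK
  -- Choose s whose sum is within ε² of the supremum. A unit vector e orthogonal to s could be added
  -- to it, so ‖K e‖² cannot exceed the remaining gap ε².
  set A : Set ℝ := {t | ∃ s : Finset E, Orthonormal ℝ (Subtype.val : ↥(s : Set E) → E) ∧
    ∑ x ∈ s, ‖K x‖ ^ 2 = t} with hA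
  have hbdd : BddAbove A := ⟨C, by rintro _ ⟨s, hs, rfl⟩; exact hC s hs⟩
  have hne : A.Nonempty := ⟨0, ∅, by
    rw [orthonormal_subtype_iff_ite]; simp, by simp⟩
  obtain ⟨_, ⟨s, hs, rfl⟩, hlt⟩ := exists_lt_of_lt_csSup hne
    (show sSup A - ε ^ 2 < sSup A by have := pow_pos hε 2; linarith)
  refine ⟨s, fun h hh => ?_⟩
  rcases eq_or_ne h 0 with rfl | h0
  · simp
  have hn : 0 < ‖h‖ := norm_pos_iff.2 h0
  set e : E := ‖h‖⁻¹ • h with he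
  have he1 : ‖e‖ = 1 := by rw [he, norm_smul, norm_inv, norm_norm, inv_mul_cancel₀ hn.ne']
  have hes : ∀ x ∈ (s : Set E), inner ℝ e x = 0 := fun x hx => by
    rw [he, real_inner_smul_left, hh x hx, mul_zero]
  have hnot : e ∉ s := fun hmem => by
    have := hes e hmem
    rw [real_inner_self_eq_norm_sq, he1] at this
    norm_num at this
  have hmem : ∑ x ∈ insert e s, ‖K x‖ ^ 2 ∈ A :=
    ⟨insert e s, by rw [Finset.coe_insert]; exact orthonormal_insert hs he1 hes, rfl⟩
  have hle := le_csSup hbdd hmem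
  rw [Finset.sum_insert hnot] at hle
  have hKe : ‖K e‖ ≤ ε := by
    refine le_of_sq_le_sq ?_ hε.le
    linarith
  rw [he, map_smul, norm_smul, norm_inv, norm_norm, inv_mul_le_iff₀ hn] at hKe
  rwa [mul_comm] at hKe

/-- K is a norm limit of finite-rank operators K ∘ P, with P the projection onto the span of the
finite set from `exists_finset`: x - P x is orthogonal to that set, so K is small there. -/
theorem IsHilbertSchmidt.isCompactOperator [CompleteSpace F] {K : E →L[ℝ] F}
    (hK : K.IsHilbertSchmidt) : IsCompactOperator K := by
  refine (isClosed_setOfPred_isCompactOperator (σ₁₂ := RingHom.id ℝ) (M₁ := E)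
    (M₂ := F)).closure_subset (Metric.mem_closure_iff.2 fun ε hε => ?_)
  obtain ⟨s, hs⟩ := hK.exists_finset (half_pos hε)
  set U : Submodule ℝ E := Submodule.span ℝ (s : Set E) with hU
  have : FiniteDimensional ℝ U := FiniteDimensional.span_finset ℝ s
  refine ⟨K.comp U.starProjection, ?_, ?_⟩
  · have h1 : IsCompactOperator (K.comp U.subtypeL) :=
      isCompactOperator_of_locallyCompactSpace_rng (K.comp U.subtypeL)
    exact h1.comp_clm U.orthogonalProjectionOnto
  · rw [dist_eq_norm]
    refine lt_of_le_of_lt (ContinuousLinearMap.opNorm_le_bound _ (half_pos hε).le fun x => ?_)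
      (half_lt_self hε)
    have hx : (K - K.comp U.starProjection) x = K (x - U.starProjection x) := by simp
    rw [hx]
    have hperp : x - U.starProjection x ∈ Uᗮ := U.sub_starProjection_mem_orthogonal x
    refine (hs _ fun y hy => ?_).trans ?_
    · exact U.inner_left_of_mem_orthogonal (Submodule.subset_span hy) hperp
    · refine mul_le_mul_of_nonneg_left ?_ (half_pos hε).le
      have h2 := Submodule.norm_sq_eq_add_norm_sq_starProjection x U
      rw [Submodule.starProjection_orthogonal_val] at h2
      refine le_of_sq_le_sq ?_ (norm_nonneg x)
      nlinarith [sq_nonneg ‖U.starProjection x‖]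

/-- The spectral theorem for a compact symmetric operator, as a Hilbert basis of eigenvectors. -/
theorem exists_hilbertBasis_eigenvectors [CompleteSpace E] {K : E →L[ℝ] E}
    (hK : IsCompactOperator K) (hsymm : (K : E →ₗ[ℝ] E).IsSymmetric) :
    ∃ (ι : Type u) (b : HilbertBasis ι ℝ E) (mu : ι → ℝ), ∀ i, K (b i) = mu i • b i := by
  have hfam := hsymm.orthogonalFamily_eigenspaces
  have hcl : ∀ μ : ℝ, IsClosed ((Module.End.eigenspace (K : E →ₗ[ℝ] E) μ : Submodule ℝ E) : Set E) := by
    intro μ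
    have : ((Module.End.eigenspace (K : E →ₗ[ℝ] E) μ : Submodule ℝ E) : Set E)
        = {x | K x = μ • x} := by
      ext x; exact Module.End.mem_eigenspace_iff
    rw [this]
    exact isClosed_eq K.continuous (continuous_const_smul μ)
  have : ∀ μ : ℝ, CompleteSpace (Module.End.eigenspace (K : E →ₗ[ℝ] E) μ) :=
    fun μ => (hcl μ).completeSpace_coe
  -- Every real μ receives a basis, which is empty when μ is not an eigenvalue. The kernel μ = 0 is
  -- included and may be infinite-dimensional.
  choose w B hB using fun μ : ℝ => exists_hilbertBasis ℝ (Module.End.eigenspace (K : E →ₗ[ℝ] E) μ)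
  have hon : Orthonormal ℝ fun a : Σ μ : ℝ, ↥(w μ) => ((B a.1 a.2 : _) : E) :=
    hfam.orthonormal_sigma_orthonormal (fun μ => (B μ).orthonormal)
  have hperp : (Submodule.span ℝ (range fun a : Σ μ : ℝ, ↥(w μ) => ((B a.1 a.2 : _) : E)))ᗮ = ⊥ := by
    rw [eq_bot_iff, ← orthogonalComplement_iSup_eigenspaces_eq_bot hK hsymm,
      ← Submodule.iInf_orthogonal]
    intro x hx
    rw [Submodule.mem_iInf]
    intro μ
    rw [Submodule.mem_orthogonal] at hx ⊢
    intro u hu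
    have hz : ∀ z : Module.End.eigenspace (K : E →ₗ[ℝ] E) μ, inner ℝ (z : E) x = 0 := by
      have hcont : IsClosed {z : Module.End.eigenspace (K : E →ₗ[ℝ] E) μ | inner ℝ (z : E) x = 0} :=
        isClosed_eq (by fun_prop) continuous_const
      have hd := (B μ).dense_span
      intro z
      have hzmem : z ∈ closure ((Submodule.span ℝ (range (B μ)) : Submodule ℝ _) : Set _) := by
        rw [← Submodule.topologicalClosure_coe, hd]; trivial
      refine closure_minimal ?_ hcont hzmem
      intro y hy
      refine Submodule.span_induction ?_ ?_ ?_ ?_ hy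
      · rintro _ ⟨i, rfl⟩
        exact hx _ (Submodule.subset_span ⟨⟨μ, i⟩, rfl⟩)
      · simp
      · intro a c _ _ ha hc
        simp only [mem_ofPred_eq] at ha hc ⊢
        rw [Submodule.coe_add, inner_add_left, ha, hc, add_zero]
      · intro r a _ ha
        simp only [mem_ofPred_eq] at ha ⊢
        rw [Submodule.coe_smul, real_inner_smul_left, ha, mul_zero]
    exact hz ⟨u, hu⟩
  refine ⟨Σ μ : ℝ, ↥(w μ), HilbertBasis.mkOfOrthogonalEqBot hon hperp, fun a => a.1, fun a => ?_⟩
  rw [HilbertBasis.coe_mkOfOrthogonalEqBot]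
  exact Module.End.mem_eigenspace_iff.1 (B a.1 a.2).2

/-- For an injective Hilbert–Schmidt operator on an infinite-dimensional space, the basis of
eigenvectors is indexed by `ℕ` and the eigenvalues are square summable. -/
theorem IsHilbertSchmidt.exists_hilbertBasis_nat [CompleteSpace E] (hE : ¬ FiniteDimensional ℝ E)
    {K : E →L[ℝ] E} (hK : K.IsHilbertSchmidt) (hsymm : (K : E →ₗ[ℝ] E).IsSymmetric)
    (hinj : ∀ x, K x = 0 → x = 0) :
    ∃ (b : HilbertBasis ℕ ℝ E) (mu : ℕ → ℝ), (∀ n, K (b n) = mu n • b n) ∧ (∀ n, mu n ≠ 0) ∧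
      Tendsto mu atTop (𝓝 0) := by
  obtain ⟨ι, b, mu, hb⟩ := exists_hilbertBasis_eigenvectors hK.isCompactOperator hsymm
  have hmu : ∀ i, mu i ≠ 0 := fun i hi => by
    have h0 := hinj (b i) (by rw [hb i, hi, zero_smul])
    have := b.orthonormal.1 i
    rw [h0, norm_zero] at this
    exact zero_ne_one this
  have hsq : ∀ (κ : Type _) (c : HilbertBasis κ ℝ E) (nu : κ → ℝ) (_ : ∀ i, K (c i) = nu i • c i),
      Summable fun i => nu i ^ 2 := fun κ c nu hc => by
    refine (hK.summable c.orthonormal).congr fun i => ?_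
    rw [hc i, norm_smul, c.orthonormal.1 i, mul_one, Real.norm_eq_abs, sq_abs]
  -- A summable family has countable support, and here every term is nonzero; separability of E is
  -- not needed.
  have : Countable ι := by
    have h1 := (hsq ι b mu hb).countable_support
    have h2 : Function.support (fun i => mu i ^ 2) = univ := by
      ext i; simp [hmu i]
    rw [h2] at h1
    exact countable_univ_iff.1 h1
  have : Infinite ι := by
    by_contra hfin
    rw [not_infinite_iff_finite] at hfin
    have := Fintype.ofFinite ι
    exact hE (Module.Basis.finiteDimensional_of_finite b.toOrthonormalBasis.toBasis)
  obtain ⟨e⟩ := nonempty_equiv_of_countable (α := ℕ) (β := ι)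
  have hperp : (Submodule.span ℝ (range (b ∘ e)))ᗮ = ⊥ := by
    rw [range_comp, e.range_eq_univ, image_univ,
      ← Submodule.topologicalClosure_eq_top_iff, b.dense_span]
  refine ⟨HilbertBasis.mkOfOrthogonalEqBot (b.orthonormal.comp e e.injective) hperp, mu ∘ e,
    fun n => ?_, fun n => hmu _, ?_⟩
  · rw [HilbertBasis.coe_mkOfOrthogonalEqBot]; exact hb (e n)
  · have h1 := ((hsq ι b mu hb).comp_injective e.injective).tendsto_atTop_zero
    have h2 := h1.sqrt
    simp only [Real.sqrt_zero, Function.comp_apply, Real.sqrt_sq_eq_abs] at h2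
    exact (tendsto_zero_iff_abs_tendsto_zero _).2 h2

end ContinuousLinearMap

end

noncomputable section

/-! ## Operators with a Hilbert–Schmidt inverse -/

namespace LinearPMap

section Inverse

variable {E : Type*} [NormedAddCommGroup E] [InnerProductSpace ℝ E]

/-- `K` is an everywhere defined bounded inverse of `T`. -/
structure IsBoundedInverse (T : E →ₗ.[ℝ] E) (K : E →L[ℝ] E) : Prop where
  mem_graph : ∀ y, (K y, y) ∈ T.graph
  apply_apply : ∀ x : T.domain, K (T x) = x

namespace IsBoundedInverse

variable {T : E →ₗ.[ℝ] E} {K : E →L[ℝ] E}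

theorem exists_domain (h : T.IsBoundedInverse K) (y : E) : ∃ x : T.domain, (x : E) = K y ∧ T x = y :=
  T.mem_graph_iff.1 (h.mem_graph y)

theorem exists_eigen (h : T.IsBoundedInverse K) {x : E} {mu : ℝ} (hmu : mu ≠ 0)
    (hx : K x = mu • x) : ∃ hd : x ∈ T.domain, T ⟨x, hd⟩ = mu⁻¹ • x := by
  obtain ⟨z, hz, hTz⟩ := h.exists_domain (mu⁻¹ • x)
  rw [_root_.map_smul, hx, smul_smul, inv_mul_cancel₀ hmu, one_smul] at hz
  subst hz
  exact ⟨z.2, hTz⟩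

/-- Transfers finite multiplicity from K to T: a compact K has finite-dimensional eigenspaces at
nonzero values. -/
theorem eigenspace_le (h : T.IsBoundedInverse K) {mu : ℝ} (hmu : mu ≠ 0) :
    T.eigenspace mu ≤ Module.End.eigenspace (K : E →ₗ[ℝ] E) mu⁻¹ := by
  rintro _ ⟨x, hx, rfl⟩
  have hx' : T x = mu • (x : E) := sub_eq_zero.1 hx
  rw [Module.End.mem_eigenspace_iff]
  have := h.apply_apply x
  rw [hx', _root_.map_smul] at this
  change K x = mu⁻¹ • (x : E)
  conv_rhs => rw [← this]
  rw [smul_smul, inv_mul_cancel₀ hmu, one_smul]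

/-- On the domain of T one has T - μ = (1 - μK) T, so K (1 - μK)⁻¹ is the bounded inverse of T - μ.
-/
theorem mem_resolventSet (h : T.IsBoundedInverse K) {mu : ℝ}
    (hu : IsUnit (1 - mu • K : E →L[ℝ] E)) : mu ∈ T.resolventSet := by
  obtain ⟨u, hu⟩ := hu
  have hR : ∀ y, (u⁻¹ : (E →L[ℝ] E)ˣ).1 (y - mu • K y) = y := fun y => by
    have := congrArg (fun A : E →L[ℝ] E => A y) u.inv_mul
    rw [hu] at this
    simpa using this
  have hL : ∀ y, (u⁻¹ : (E →L[ℝ] E)ˣ).1 y - mu • K ((u⁻¹ : (E →L[ℝ] E)ˣ).1 y) = y := fun y => by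
    have := congrArg (fun A : E →L[ℝ] E => A y) u.mul_inv
    rw [hu] at this
    simpa using this
  set R := (u⁻¹ : (E →L[ℝ] E)ˣ).1
  have hx : ∀ x : T.domain, (x : E) = K (R (T.shift mu x)) := fun x => by
    have h1 : T.shift mu x = T x - mu • K (T x) := by rw [h.apply_apply x]; rfl
    rw [h1, hR, h.apply_apply]
  refine ⟨⟨fun x y hxy => ?_, fun y => ?_⟩, ‖K‖ * ‖R‖, fun x => ?_⟩
  · apply Subtype.ext
    rw [hx x, hx y]
    exact congrArg (fun z => K (R z)) hxy
  · obtain ⟨x, hxK, hTx⟩ := h.exists_domain (R y)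
    refine ⟨x, ?_⟩
    change T x - mu • (x : E) = y
    rw [hTx, hxK, hL]
  · conv_lhs => rw [hx x]
    rw [mul_assoc]
    exact (K.le_opNorm _).trans (mul_le_mul_of_nonneg_left (R.le_opNorm _) (norm_nonneg _))

end IsBoundedInverse

/-- Only finitely many terms lie below x + 1, whereas an accumulation point needs infinitely many
values nearby. -/
theorem not_accPt_range_of_tendsto_atTop {lam : ℕ → ℝ} (h : Tendsto lam atTop atTop) (x : ℝ) :
    ¬ AccPt x (𝓟 (range lam)) := by
  intro hx
  have h1 := hx.nhds_inter (Iio_mem_nhds (lt_add_one x))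
  refine Set.Infinite.of_accPt h1 ?_
  have hfin : {n | ¬ x + 1 ≤ lam n}.Finite := by
    have := h.eventually_ge_atTop (x + 1)
    rwa [← Nat.cofinite_eq_atTop, eventually_cofinite] at this
  refine (hfin.image lam).subset ?_
  rintro _ ⟨h2, n, rfl⟩
  exact ⟨n, not_le.2 h2, rfl⟩

/-- An operator with a positive Hilbert–Schmidt inverse has discrete spectrum and a Hilbert basis
of eigenvectors. -/
theorem IsBoundedInverse.hasDiscreteSpectrum [CompleteSpace E] (hE : ¬ FiniteDimensional ℝ E)
    {T : E →ₗ.[ℝ] E} {K : E →L[ℝ] E} (h : T.IsBoundedInverse K) (hK : K.IsHilbertSchmidt)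
    (hsymm : (K : E →ₗ[ℝ] E).IsSymmetric) (hinj : ∀ x, K x = 0 → x = 0)
    (hpos : ∀ x, 0 ≤ inner ℝ (K x) x) :
    T.HasDiscreteSpectrum ∧ ∃ (b : HilbertBasis ℕ ℝ E) (lam : ℕ → ℝ), (∀ n, 0 < lam n) ∧
      Tendsto lam atTop atTop ∧ T.spectrum = range lam ∧ (∀ n, b n = lam n • K (b n)) ∧
      ∀ n, ∃ hd : b n ∈ T.domain, T ⟨b n, hd⟩ = lam n • b n := by
  obtain ⟨b, mu, hb, hmu, hlim⟩ := hK.exists_hilbertBasis_nat hE hsymm hinj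
  have hmupos : ∀ n, 0 < mu n := fun n => by
    refine lt_of_le_of_ne ?_ (hmu n).symm
    have := hpos (b n)
    rwa [hb n, real_inner_smul_left, real_inner_self_eq_norm_sq, b.orthonormal.1 n, one_pow,
      mul_one] at this
  have hb0 : ∀ n, b n ≠ 0 := fun n => b.orthonormal.ne_zero n
  set lam : ℕ → ℝ := fun n => (mu n)⁻¹ with hlam
  have htop : Tendsto lam atTop atTop :=
    (tendsto_nhdsWithin_iff.2 ⟨hlim, Eventually.of_forall hmupos⟩).inv_tendsto_nhdsGT_zero
  have heig : ∀ n, ∃ hd : b n ∈ T.domain, T ⟨b n, hd⟩ = lam n • b n := fun n =>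
    h.exists_eigen (hmu n) (hb n)
  have heig' : ∀ n, b n ∈ T.eigenspace (lam n) := fun n => by
    obtain ⟨hd, hTd⟩ := heig n
    exact ⟨⟨b n, hd⟩, sub_eq_zero.2 hTd, rfl⟩
  have hspec : T.spectrum = range lam := by
    ext x
    constructor
    · intro hx
      by_contra hnot
      refine hx (h.mem_resolventSet ?_)
      rcases eq_or_ne x 0 with rfl | hx0
      · simp
      -- By symmetry, an eigenvector z of K for x⁻¹ is orthogonal to every b n with mu n ≠ x⁻¹. If x
      -- is no lam n, then z is orthogonal to the whole basis and vanishes; the Fredholm alternative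
      -- does the rest.
      have hne : ¬ Module.End.HasEigenvalue (K : Module.End ℝ E) x⁻¹ := by
        intro hev
        obtain ⟨z, hz⟩ := hev.exists_hasEigenvector
        have hKz : K z = x⁻¹ • z := hz.apply_eq_smul
        refine hz.2 (b.repr.map_eq_zero_iff.1 (lp.ext (funext fun n => ?_)))
        refine (b.repr_apply_apply z n).trans ?_
        change _ = (0 : ℝ)
        have h1 : inner ℝ (K (b n)) z = inner ℝ (b n) (K z) := hsymm (b n) z
        rw [hb n, hKz, real_inner_smul_left, real_inner_smul_right] at h1
        by_contra h0
        have h2 : mu n = x⁻¹ := mul_right_cancel₀ h0 h1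
        exact hnot ⟨n, by rw [hlam]; simp [h2]⟩
      have hr := (hK.isCompactOperator.hasEigenvalue_or_mem_resolventSet (inv_ne_zero hx0)).resolve_left hne
      rw [_root_.spectrum.mem_resolventSet_iff] at hr
      -- 1 - xK = x (x⁻¹ - K).
      have h3 := hr.smul (Units.mk0 x hx0)
      convert h3 using 1
      ext y
      simp [smul_sub, hx0, Units.smul_def, Algebra.algebraMap_eq_smul_one]
    · rintro ⟨n, rfl⟩ ⟨⟨hi, -⟩, -⟩
      obtain ⟨hd, hTd⟩ := heig n
      have h0 : T.shift (lam n) ⟨b n, hd⟩ = 0 := sub_eq_zero.2 hTd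
      have := hi (h0.trans (_root_.map_zero (T.shift (lam n))).symm)
      exact hb0 n (congrArg Subtype.val this)
  have hlampos : ∀ n, 0 < lam n := fun n => inv_pos.2 (hmupos n)
  refine ⟨⟨?_, ?_, ?_⟩, b, lam, hlampos, htop, hspec, fun n => ?_, heig⟩
  · rw [hspec]
    rintro _ ⟨n, rfl⟩ hbot
    have := heig' n
    rw [hbot] at this
    exact hb0 n this
  · rw [hspec]
    rintro _ ⟨n, rfl⟩
    have := ContinuousLinearMap.finite_dimensional_eigenspace hK.isCompactOperator (lam n)⁻¹
      (inv_ne_zero (hlampos n).ne')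
    exact Submodule.finiteDimensional_of_le (h.eigenspace_le (hlampos n).ne')
  · rw [hspec]
    exact not_accPt_range_of_tendsto_atTop htop
  · rw [hb n, smul_smul, inv_mul_cancel₀ (hmu n), one_smul]

end Inverse

/-! ### Inverting a Friedrichs extension -/

section FriedrichsInverse

variable {E : Type*} [NormedAddCommGroup E] [InnerProductSpace ℝ E]

/-- On the dense set where f = T (K f), the form ⟨K f, f⟩ is the energy of K f; continuity extends
the inequality. -/
theorem inner_nonneg_of_rightInverse {T : E →ₗ.[ℝ] E} (hT : ∀ x : T.domain, 0 ≤ T.energy x)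
    {K : E →L[ℝ] E} (hr : Dense {f : E | (K f, f) ∈ T.graph}) (x : E) : 0 ≤ inner ℝ (K x) x := by
  refine hr.induction (P := fun x => 0 ≤ inner ℝ (K x) x) (fun f hf => ?_) ?_ x
  · obtain ⟨w, hw, hTw⟩ := T.mem_graph_iff.1 hf
    simp only at hw hTw
    have := hT w
    rw [energy, hTw, hw] at this
    rw [real_inner_comm]
    exact this
  · exact isClosed_le continuous_const (by fun_prop)

/-- If K x = 0, then ⟨x, v⟩ = ⟨x, K T v⟩ = ⟨K x, T v⟩ = 0 for all v in the dense domain. -/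
theorem eq_zero_of_leftInverse {T : E →ₗ.[ℝ] E} (hd : Dense (T.domain : Set E)) {K : E →L[ℝ] E}
    (hsymm : (K : E →ₗ[ℝ] E).IsSymmetric) (hl : ∀ x : T.domain, K (T x) = x) (x : E)
    (hx : K x = 0) : x = 0 := by
  refine hd.eq_zero_of_inner_left ℝ fun v hv => ?_
  have h1 : inner ℝ (K x) (T ⟨v, hv⟩) = inner ℝ x (K (T ⟨v, hv⟩)) := hsymm _ _
  rw [hl, hx, inner_zero_left] at h1
  exact h1.symm

variable [CompleteSpace E]

theorem mem_graph_friedrichsExtension_iff {T : E →ₗ.[ℝ] E} {hT : ∀ x : T.domain, 0 ≤ T.energy x}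
    {p : E × E} : p ∈ (T.friedrichsExtension hT).graph ↔
      p.1 ∈ T.energySpace hT ∧ p ∈ T.adjoint.graph := by
  simp only [mem_graph_iff]
  constructor
  · rintro ⟨y, hy, hy'⟩
    have hd := y.2
    exact ⟨hy ▸ hd.1, ⟨(y : E), hd.2⟩, hy, (domRestrict_apply rfl).symm.trans hy'⟩
  · rintro ⟨he, y, hy, hy'⟩
    exact ⟨⟨(y : E), by rw [hy]; exact he, y.2⟩, hy, (domRestrict_apply rfl).trans hy'⟩

/-- If `K` is a bounded symmetric left inverse of a densely defined positive operator `T` and a right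
inverse on a dense subspace, then `K` inverts the Friedrichs extension of `T`. -/
theorem isBoundedInverse_friedrichsExtension {T : E →ₗ.[ℝ] E}
    (hT : ∀ x : T.domain, 0 ≤ T.energy x) (hd : Dense (T.domain : Set E)) {K : E →L[ℝ] E}
    (hsymm : (K : E →ₗ[ℝ] E).IsSymmetric) (hl : ∀ x : T.domain, K (T x) = x)
    (hr : Dense {f : E | (K f, f) ∈ T.graph}) :
    (T.friedrichsExtension hT).IsBoundedInverse K := by
  have hs : ∀ x y, inner ℝ (K x) y = inner ℝ x (K y) := fun x y => hsymm x y
  have hadj : ∀ f, ∀ x : T.domain, inner ℝ f (x : E) = inner ℝ (K f) (T x) := fun f x => by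
    rw [hs, hl]
  refine ⟨fun f => ?_, fun x => ?_⟩
  · rw [mem_graph_friedrichsExtension_iff]
    have hdom : K f ∈ T.adjoint.domain := mem_adjoint_domain_of_exists _ ⟨f, hadj f⟩
    refine ⟨?_, T.adjoint.mem_graph_iff.2 ⟨⟨K f, hdom⟩, rfl, adjoint_apply_eq hd _ (hadj f)⟩⟩
    -- Approximate f by u n with w n = K (u n) in the domain of T and T (w n) = u n. The energy of w
    -- n - w m is ⟨u n - u m, K (u n - u m)⟩, so the w n are Cauchy in energy and converge to K f.
    obtain ⟨u, hu, hlim⟩ := mem_closure_iff_seq_limit.1 (hr f)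
    choose w hw hTw using fun n => T.mem_graph_iff.1 (hu n)
    refine ⟨w, ?_, ?_⟩
    · simp only [hw]
      exact (K.continuous.tendsto f).comp hlim
    · have he : ∀ p : ℕ × ℕ, T.energy (w p.1 - w p.2)
          = inner ℝ (u p.1 - u p.2) (K (u p.1 - u p.2)) := fun p => by
        rw [energy, LinearPMap.map_sub, Submodule.coe_sub, hTw, hTw, hw, hw, _root_.map_sub]
        rfl
      simp only [he]
      have h1 : Tendsto (fun p : ℕ × ℕ => u p.1 - u p.2) atTop (𝓝 (f - f)) := by
        rw [← prod_atTop_atTop_eq]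
        exact (hlim.comp tendsto_fst).sub (hlim.comp tendsto_snd)
      have h2 := h1.inner (𝕜 := ℝ) ((K.continuous.tendsto _).comp h1)
      simpa using h2
  · obtain ⟨-, hx⟩ := mem_graph_friedrichsExtension_iff.1 ((T.friedrichsExtension hT).mem_graph x)
    obtain ⟨z, hz, hz'⟩ := T.adjoint.mem_graph_iff.1 hx
    simp only at hz hz'
    rw [← hz', ← hz]
    refine hr.eq_of_inner_left ℝ fun f hf => ?_
    obtain ⟨w, hw, hTw⟩ := T.mem_graph_iff.1 hf
    simp only at hw hTw
    have := adjoint_isFormalAdjoint hd z w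
    rw [hw, hTw] at this
    rw [hs]
    exact this

end FriedrichsInverse

end LinearPMap

end

noncomputable section

/-! ## Integral operators with a square integrable kernel -/

namespace KernelOperator

variable {α : Type*} [MeasurableSpace α] {μ : Measure α} {k : α → α → ℝ} {h : α → ℝ}

/-- The integral operator with kernel `k`, on functions. -/
def kernelFun (μ : Measure α) (k : α → α → ℝ) (f : α → ℝ) (x : α) : ℝ := ∫ y, k x y * f y ∂μ

theorem kernelFun_congr_ae {f g : α → ℝ} (hfg : f =ᵐ[μ] g) : kernelFun μ k f = kernelFun μ k g :=
  funext fun x => integral_congr_ae (hfg.mono fun y hy => by simp only [hy])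

/-- Almost every section of a kernel dominated by `h x * h y` represents a functional on `L²`. -/
theorem ae_exists_section (hk : Measurable (Function.uncurry k)) (hh : MemLp h 2 μ)
    (hb : ∀ᵐ x ∂μ, ∀ᵐ y ∂μ, |k x y| ≤ h x * h y) :
    ∀ᵐ x ∂μ, ∃ κ : Lp ℝ 2 μ, ‖κ‖ ≤ ‖h x‖ * ‖hh.toLp h‖ ∧
      ∀ f : Lp ℝ 2 μ, kernelFun μ k f x = inner ℝ κ f := by
  filter_upwards [hb] with x hx
  have hle : ∀ᵐ y ∂μ, ‖k x y‖ ≤ ‖h x‖ * ‖h y‖ := by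
    filter_upwards [hx] with y hy
    rw [← norm_mul]
    exact hy.trans (le_abs_self _)
  have hm : MemLp (k x) 2 μ :=
    hh.of_le_mul (hk.of_uncurry_left).aestronglyMeasurable hle
  refine ⟨hm.toLp, ?_, fun f => ?_⟩
  · refine Lp.norm_le_mul_norm_of_ae_le_mul ?_
    filter_upwards [hle, hm.coeFn_toLp, hh.coeFn_toLp] with y h1 h2 h3
    rwa [h2, h3]
  · rw [L2.inner_def, kernelFun]
    refine integral_congr_ae ?_
    filter_upwards [hm.coeFn_toLp] with y hy
    rw [hy]
    simp [mul_comm]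

theorem memLp_kernelFun [SFinite μ] (hk : Measurable (Function.uncurry k)) (hh : MemLp h 2 μ)
    (hb : ∀ᵐ x ∂μ, ∀ᵐ y ∂μ, |k x y| ≤ h x * h y) (f : Lp ℝ 2 μ) :
    MemLp (kernelFun μ k f) 2 μ := by
  have hmeas : AEStronglyMeasurable (kernelFun μ k f) μ := by
    have h1 : AEStronglyMeasurable (fun p : α × α => k p.1 p.2 * f p.2) (μ.prod μ) :=
      hk.aestronglyMeasurable.mul (Lp.aestronglyMeasurable f).comp_snd
    exact h1.integral_prod_right'
  refine (hh.of_le_mul (c := ‖hh.toLp h‖ * ‖f‖) hmeas ?_)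
  filter_upwards [ae_exists_section hk hh hb] with x ⟨κ, h1, h2⟩
  rw [h2 f]
  refine (norm_inner_le_norm _ _).trans ?_
  calc ‖κ‖ * ‖f‖ ≤ (‖h x‖ * ‖hh.toLp h‖) * ‖f‖ := by gcongr
    _ = _ := by ring

/-- The integral operator on `L²` whose kernel is dominated by `h x * h y` with `h ∈ L²`. -/
def operator [SFinite μ] (hk : Measurable (Function.uncurry k)) (hh : MemLp h 2 μ)
    (hb : ∀ᵐ x ∂μ, ∀ᵐ y ∂μ, |k x y| ≤ h x * h y) : Lp ℝ 2 μ →L[ℝ] Lp ℝ 2 μ :=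
  LinearMap.mkContinuous
    { toFun := fun f => (memLp_kernelFun hk hh hb f).toLp
      map_add' := fun f g => by
        refine Lp.ext ?_
        filter_upwards [Lp.coeFn_add (memLp_kernelFun hk hh hb f).toLp
          (memLp_kernelFun hk hh hb g).toLp, (memLp_kernelFun hk hh hb f).coeFn_toLp,
          (memLp_kernelFun hk hh hb g).coeFn_toLp, (memLp_kernelFun hk hh hb (f + g)).coeFn_toLp,
          ae_exists_section hk hh hb] with x h1 h2 h3 h4 ⟨κ, _, h5⟩
        rw [h1, Pi.add_apply, h2, h3, h4, h5, h5, h5, inner_add_right]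
      map_smul' := fun c f => by
        refine Lp.ext ?_
        filter_upwards [Lp.coeFn_smul c (memLp_kernelFun hk hh hb f).toLp,
          (memLp_kernelFun hk hh hb f).coeFn_toLp,
          (memLp_kernelFun hk hh hb (c • f)).coeFn_toLp,
          ae_exists_section hk hh hb] with x h1 h2 h4 ⟨κ, _, h5⟩
        rw [RingHom.id_apply, h1, Pi.smul_apply, h2, h4, h5, h5, inner_smul_right, smul_eq_mul] }
    (‖hh.toLp h‖ ^ 2) (fun f => by
      have : ‖(memLp_kernelFun hk hh hb f).toLp‖ ≤ (‖hh.toLp h‖ * ‖f‖) * ‖hh.toLp h‖ := by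
        refine Lp.norm_le_mul_norm_of_ae_le_mul ?_
        filter_upwards [ae_exists_section hk hh hb, hh.coeFn_toLp,
          (memLp_kernelFun hk hh hb f).coeFn_toLp] with x ⟨κ, h1, h2⟩ h3 h4
        rw [h4, h3, h2 f]
        refine (norm_inner_le_norm _ _).trans ?_
        calc ‖κ‖ * ‖f‖ ≤ (‖h x‖ * ‖hh.toLp h‖) * ‖f‖ := by gcongr
          _ = _ := by ring
      refine this.trans (le_of_eq ?_)
      ring)

theorem operator_apply_ae [SFinite μ] (hk : Measurable (Function.uncurry k)) (hh : MemLp h 2 μ)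
    (hb : ∀ᵐ x ∂μ, ∀ᵐ y ∂μ, |k x y| ≤ h x * h y) (f : Lp ℝ 2 μ) :
    operator hk hh hb f =ᵐ[μ] kernelFun μ k f :=
  (memLp_kernelFun hk hh hb f).coeFn_toLp

theorem norm_sq_eq_integral (f : Lp ℝ 2 μ) : ‖f‖ ^ 2 = ∫ x, f x ^ 2 ∂μ := by
  rw [← real_inner_self_eq_norm_sq, L2.inner_def]
  exact integral_congr_ae (Eventually.of_forall fun x => by simp [sq])

theorem integrable_sq (f : Lp ℝ 2 μ) : Integrable (fun x => f x ^ 2) μ :=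
  (Lp.memLp f).integrable_sq

/-- For almost every x the value of the image of f at x is ⟨κ, f⟩ with ‖κ‖ ≤ |h x| ‖h‖. Bessel's
inequality bounds the sum of squares over an orthonormal set by ‖κ‖², and this bound is integrable
in x. -/
theorem isHilbertSchmidt_operator [SFinite μ] (hk : Measurable (Function.uncurry k))
    (hh : MemLp h 2 μ) (hb : ∀ᵐ x ∂μ, ∀ᵐ y ∂μ, |k x y| ≤ h x * h y) :
    (operator hk hh hb).IsHilbertSchmidt := by
  refine ⟨∫ x, h x ^ 2 * ‖hh.toLp h‖ ^ 2 ∂μ, fun s hs => ?_⟩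
  simp only [norm_sq_eq_integral (operator hk hh hb _)]
  rw [← integral_finsetSum _ fun f _ => integrable_sq _]
  refine integral_mono_ae (integrable_finsetSum _ fun f _ => integrable_sq _)
    (hh.integrable_sq.mul_const _) ?_
  have hall : ∀ᵐ x ∂μ, ∀ f ∈ s, operator hk hh hb f x = kernelFun μ k f x :=
    (ae_ball_iff s.countable_toSet).2 fun f _ => operator_apply_ae hk hh hb f
  filter_upwards [ae_exists_section hk hh hb, hall] with x ⟨κ, h1, h2⟩ h3
  calc ∑ f ∈ s, operator hk hh hb f x ^ 2
      = ∑ f ∈ s.attach, ‖inner ℝ (f : Lp ℝ 2 μ) κ‖ ^ 2 := by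
        rw [← Finset.sum_attach]
        refine Finset.sum_congr rfl fun f _ => ?_
        rw [h3 f f.2, h2, real_inner_comm, Real.norm_eq_abs, sq_abs]
    _ ≤ ‖κ‖ ^ 2 := Orthonormal.sum_inner_products_le κ hs
    _ ≤ (‖h x‖ * ‖hh.toLp h‖) ^ 2 := by gcongr
    _ = _ := by rw [mul_pow, Real.norm_eq_abs, sq_abs]

/-- Fubini for k x y * f y * g x, which is dominated by the product of the integrable functions h g
and h f. Measurability of h turns the iterated almost-everywhere bound into one on the product
space. -/
theorem isSymmetric_operator [SFinite μ] (hk : Measurable (Function.uncurry k))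
    (hh : MemLp h 2 μ) (hb : ∀ᵐ x ∂μ, ∀ᵐ y ∂μ, |k x y| ≤ h x * h y) (hm : Measurable h)
    (hsymm : ∀ x y, k x y = k y x) :
    (operator hk hh hb : Lp ℝ 2 μ →ₗ[ℝ] Lp ℝ 2 μ).IsSymmetric := by
  intro f g
  have hint : Integrable (Function.uncurry fun x y => k x y * f y * g x) (μ.prod μ) := by
    have h1 : Integrable (fun x => h x * g x) μ := hh.integrable_mul (Lp.memLp g)
    have h2 : Integrable (fun x => h x * f x) μ := hh.integrable_mul (Lp.memLp f)
    refine (h1.mul_prod h2).mono ?_ ?_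
    · exact (hk.aestronglyMeasurable.mul (Lp.aestronglyMeasurable f).comp_snd).mul
        (Lp.aestronglyMeasurable g).comp_fst
    · have hprod : ∀ᵐ p ∂μ.prod μ, |k p.1 p.2| ≤ h p.1 * h p.2 := by
        refine (Measure.ae_prod_iff_ae_ae ?_).2 hb
        exact measurableSet_le hk.abs ((hm.comp measurable_fst).mul (hm.comp measurable_snd))
      filter_upwards [hprod] with p hp
      simp only [Function.uncurry, norm_mul, Real.norm_eq_abs] at hp ⊢
      calc |k p.1 p.2| * |f p.2| * |g p.1| ≤ |h p.1 * h p.2| * |f p.2| * |g p.1| :=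
            mul_le_mul_of_nonneg_right (mul_le_mul_of_nonneg_right (hp.trans (le_abs_self _))
              (abs_nonneg _)) (abs_nonneg _)
        _ = _ := by rw [abs_mul]; ring
  have hl : inner ℝ (operator hk hh hb f) g = ∫ x, ∫ y, k x y * f y * g x ∂μ ∂μ := by
    rw [L2.inner_def]
    refine integral_congr_ae ?_
    filter_upwards [operator_apply_ae hk hh hb f] with x hx
    rw [hx, integral_mul_const]
    simp [kernelFun, mul_comm]
  have hr : inner ℝ f (operator hk hh hb g) = ∫ y, ∫ x, k x y * f y * g x ∂μ ∂μ := by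
    rw [L2.inner_def]
    refine integral_congr_ae ?_
    filter_upwards [operator_apply_ae hk hh hb g] with y hy
    rw [hy, kernelFun]
    simp only [RCLike.inner_apply, conj_trivial]
    rw [← integral_mul_const]
    refine integral_congr_ae (Eventually.of_forall fun x => ?_)
    simp only [hsymm x y]
    ring
  change inner ℝ (operator hk hh hb f) g = inner ℝ f (operator hk hh hb g)
  rw [hl, hr, integral_integral_swap hint]

end KernelOperator

end

noncomputable section

/-! ## Green's function of the degenerate operator -/

namespace Degenerate

/-- The solution `∫ t in x..1, t ^ (-β)` of `(x ^ β q')' = 0` with `q 1 = 0`. -/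
def potential (β x : ℝ) : ℝ := (1 - x ^ (1 - β)) / (1 - β)

/-- The coefficient of the rank-one correction in Green's function: it accounts for the boundary
condition at `0`, which is present only if `β < 1`. -/
def coupling (β : ℝ) : ℝ := max 0 (1 - β)

/-- Green's function of the degenerate operator. -/
def green (β x y : ℝ) : ℝ :=
  potential β (max x y) - coupling β * potential β x * potential β y

/-- The solution operator of `-(x ^ β u')' = f`, on functions. -/
def greenFun (β : ℝ) (f : ℝ → ℝ) : ℝ → ℝ :=
  KernelOperator.kernelFun (volume.restrict (Ioo (0 : ℝ) 1)) (green β) f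

variable {β : ℝ}

theorem coupling_of_lt (h : β < 1) : coupling β = 1 - β := max_eq_right (by linarith)

theorem coupling_of_gt (h : 1 < β) : coupling β = 0 := max_eq_left (by linarith)

theorem potential_one : potential β 1 = 0 := by simp [potential]

theorem potential_zero (h : β ≠ 1) : potential β 0 = (1 - β)⁻¹ := by
  rw [potential, Real.zero_rpow (sub_ne_zero.2 h.symm), sub_zero, one_div]

theorem hasDerivAt_potential (h : β ≠ 1) {x : ℝ} (hx : 0 < x) :
    HasDerivAt (potential β) (-x ^ (-β)) x := by
  have h1 : 1 - β ≠ 0 := sub_ne_zero.2 h.symm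
  have := ((Real.hasDerivAt_rpow_const (p := 1 - β) (Or.inl hx.ne')).const_sub 1).div_const (1 - β)
  refine this.congr_deriv ?_
  rw [show 1 - β - 1 = -β by ring]
  field_simp

theorem continuousAt_potential {x : ℝ} (h : x ≠ 0 ∨ β < 1) : ContinuousAt (potential β) x := by
  refine (continuousAt_const.sub (Real.continuousAt_rpow_const x (1 - β) ?_)).div_const _
  exact h.imp id fun h => by linarith

theorem measurable_potential : Measurable (potential β) := by
  unfold potential; fun_prop

theorem measurable_green : Measurable (Function.uncurry (green β)) := by
  have := measurable_potential (β := β)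
  unfold green Function.uncurry
  fun_prop

theorem green_comm (x y : ℝ) : green β x y = green β y x := by
  rw [green, green, max_comm]; ring

theorem green_one_left {y : ℝ} (hy : y ≤ 1) : green β 1 y = 0 := by
  rw [green, max_eq_left hy, potential_one]; ring

theorem green_zero_left (hβ : β < 1) {y : ℝ} (hy : 0 ≤ y) : green β 0 y = 0 := by
  have h1 : 1 - β ≠ 0 := by linarith
  rw [green, max_eq_right hy, potential_zero hβ.ne, coupling_of_lt hβ]
  field_simp
  ring

/-- One exponent, max 0 (β - 1), covers both cases: the potential is bounded for β < 1 and grows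
like x^(1 - β) at 0 for β > 1. In the latter case x = 0 is excluded, because the convention 0 ^ (1 -
β) = 0 makes `potential β 0` negative. -/
theorem potential_nonneg_le (h : β ≠ 1) {x : ℝ} (hx : 0 < x ∨ β < 1) (hx0 : 0 ≤ x) (hx1 : x ≤ 1) :
    0 ≤ potential β x ∧ potential β x ≤ |1 - β|⁻¹ * x ^ (-max 0 (β - 1)) := by
  rcases lt_or_gt_of_ne h with hβ | hβ
  · have h1 : 0 < 1 - β := by linarith
    rw [max_eq_left (by linarith), neg_zero, Real.rpow_zero, abs_of_pos h1, mul_one, potential]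
    refine ⟨div_nonneg (sub_nonneg.2 (Real.rpow_le_one hx0 hx1 h1.le)) h1.le, ?_⟩
    rw [div_eq_inv_mul]
    refine mul_le_of_le_one_right (inv_pos.2 h1).le ?_
    linarith [Real.rpow_nonneg hx0 (1 - β)]
  · have h1 : 0 < β - 1 := by linarith
    have hxp : 0 < x := hx.resolve_right (by linarith)
    rw [max_eq_right h1.le, abs_sub_comm, abs_of_pos h1, neg_sub, potential,
      show (1 - x ^ (1 - β)) / (1 - β) = (β - 1)⁻¹ * (x ^ (1 - β) - 1) by
        rw [← neg_sub (x ^ (1 - β)) 1, ← neg_sub β 1, neg_div_neg_eq, div_eq_inv_mul]]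
    have h2 := Real.one_le_rpow_of_pos_of_le_one_of_nonpos hxp hx1 (show 1 - β ≤ 0 by linarith)
    have h3 : 0 ≤ (β - 1)⁻¹ := (inv_pos.2 h1).le
    exact ⟨mul_nonneg h3 (by linarith), mul_le_mul_of_nonneg_left (by linarith) h3⟩

/-- Green's function is dominated by every product of powers with the right total exponent. -/
theorem abs_green_le (h : β ≠ 1) {a b : ℝ} (ha : 0 ≤ a) (hb : 0 ≤ b)
    (hab : a + b = max 0 (β - 1)) {x y : ℝ} (hx : 0 < x ∨ a = 0) (hx0 : 0 ≤ x) (hx1 : x ≤ 1)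
    (hy0 : 0 < y) (hy1 : y ≤ 1) : |green β x y| ≤ |1 - β|⁻¹ * (x ^ (-a) * y ^ (-b)) := by
  have hm0 : 0 < max x y := lt_max_of_lt_right hy0
  have hm := potential_nonneg_le h (Or.inl hm0) hm0.le (max_le hx1 hy1)
  rcases lt_or_gt_of_ne h with hβ | hβ
  · have h1 : 0 < 1 - β := by linarith
    rw [max_eq_left (by linarith)] at hab
    obtain rfl : a = 0 := by linarith
    obtain rfl : b = 0 := by linarith
    have hX := potential_nonneg_le h (Or.inr hβ) hx0 hx1
    have hY := potential_nonneg_le h (Or.inr hβ) hy0.le hy1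
    rw [max_eq_left (show β - 1 ≤ 0 by linarith)] at hm hX hY
    simp only [neg_zero, Real.rpow_zero, mul_one, abs_of_pos h1] at hm hX hY ⊢
    rw [green, coupling_of_lt hβ]
    -- For β < 1 both terms of `green` lie in [0, (1 - β)⁻¹], hence so does the absolute value of
    -- their difference.
    have h4 : (1 - β) * potential β x * potential β y ≤ (1 - β)⁻¹ := by
      have : (1 - β) * potential β x ≤ 1 := by
        calc (1 - β) * potential β x ≤ (1 - β) * (1 - β)⁻¹ :=
              mul_le_mul_of_nonneg_left hX.2 h1.le
          _ = 1 := mul_inv_cancel₀ h1.ne'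
      calc _ ≤ 1 * potential β y := mul_le_mul_of_nonneg_right this hY.1
        _ ≤ _ := by rw [one_mul]; exact hY.2
    have h5 : 0 ≤ (1 - β) * potential β x * potential β y :=
      mul_nonneg (mul_nonneg h1.le hX.1) hY.1
    rw [abs_le]
    constructor <;> linarith [hm.1, hm.2]
  · rw [green, coupling_of_gt hβ, zero_mul, zero_mul, sub_zero, abs_of_nonneg hm.1]
    refine hm.2.trans (mul_le_mul_of_nonneg_left ?_ (by positivity))
    -- Split the power of max x y into exponents -a and -b; being nonpositive, they allow max x y to
    -- be replaced by x in one factor and y in the other.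
    rw [← hab, neg_add, Real.rpow_add hm0]
    refine mul_le_mul ?_ ?_ (Real.rpow_nonneg hm0.le _) (Real.rpow_nonneg hx0 _)
    · rcases hx with hx | rfl
      · exact Real.rpow_le_rpow_of_nonpos hx (le_max_left _ _) (by linarith)
      · simp
    · exact Real.rpow_le_rpow_of_nonpos hy0 (le_max_right _ _) (by linarith)

theorem continuousOn_green {y : ℝ} (hy : 0 < y) (h : β ≠ 1) :
    ContinuousOn (fun x => green β x y) (Icc 0 1) := by
  intro x hx
  refine ContinuousAt.continuousWithinAt ?_
  have h1 : ContinuousAt (fun x => potential β (max x y)) x :=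
    ContinuousAt.comp (f := fun x => max x y) (continuousAt_potential
      (Or.inl (lt_max_of_lt_right hy).ne')) (by fun_prop)
  rcases lt_or_gt_of_ne h with hβ | hβ
  · exact h1.sub ((continuousAt_const.mul (continuousAt_potential (Or.inr hβ))).mul
      continuousAt_const)
  · simpa only [green, coupling_of_gt hβ, zero_mul, sub_zero] using h1

theorem integrableOn_rpow_neg {s : ℝ} (hs : s < 1) :
    IntegrableOn (fun y : ℝ => y ^ (-s)) (Ioo 0 1) :=
  (intervalIntegral.integrableOn_Ioo_rpow_iff one_pos).2 (by linarith)

/-- The solution operator improves the decay exponent of its argument. -/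
theorem exists_abs_greenFun_le (h : β ≠ 1) {a b s C : ℝ} (ha : 0 ≤ a) (hb : 0 ≤ b)
    (hab : a + b = max 0 (β - 1)) (hs : b + s < 1) {f : ℝ → ℝ}
    (hf : ∀ᵐ y ∂volume.restrict (Ioo (0 : ℝ) 1), |f y| ≤ C * y ^ (-s)) :
    ∃ C' : ℝ, ∀ x ∈ Ioo (0 : ℝ) 1, |greenFun β f x| ≤ C' * x ^ (-a) := by
  refine ⟨|1 - β|⁻¹ * (C * ∫ y in Ioo (0 : ℝ) 1, y ^ (-(b + s))), fun x hx => ?_⟩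
  have hle : |greenFun β f x| ≤ ∫ y in Ioo (0 : ℝ) 1,
      (|1 - β|⁻¹ * C * x ^ (-a)) * y ^ (-(b + s)) := by
    change ‖∫ y in Ioo (0 : ℝ) 1, green β x y * f y‖ ≤ _
    refine norm_integral_le_of_norm_le ((integrableOn_rpow_neg hs).const_mul _) ?_
    filter_upwards [hf, ae_restrict_mem measurableSet_Ioo] with y hy hy01
    have h1 := abs_green_le h ha hb hab (Or.inl hx.1) hx.1.le hx.2.le hy01.1 hy01.2.le
    rw [norm_mul, Real.norm_eq_abs, Real.norm_eq_abs, neg_add, Real.rpow_add hy01.1]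
    calc |green β x y| * |f y| ≤ (|1 - β|⁻¹ * (x ^ (-a) * y ^ (-b))) * (C * y ^ (-s)) :=
          mul_le_mul h1 hy (abs_nonneg _) ((abs_nonneg _).trans h1)
      _ = _ := by ring
  refine hle.trans (le_of_eq ?_)
  rw [integral_const_mul]
  ring

/-- The solution operator maps bounded functions to continuous functions. -/
theorem continuousOn_greenFun (h : β ≠ 1) (hβ2 : β < 2) {f : ℝ → ℝ} {M : ℝ}
    (hm : AEStronglyMeasurable f (volume.restrict (Ioo (0 : ℝ) 1)))
    (hf : ∀ᵐ y ∂volume.restrict (Ioo (0 : ℝ) 1), |f y| ≤ M) :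
    ContinuousOn (greenFun β f) (Icc 0 1) := by
  have hs : max 0 (β - 1) < 1 := max_lt one_pos (by linarith)
  refine continuousOn_of_dominated (bound := fun y => (|1 - β|⁻¹ * M) * y ^ (-max 0 (β - 1)))
    (fun x _ => ?_) (fun x hx => ?_) ((integrableOn_rpow_neg hs).const_mul _) ?_
  · exact (measurable_green.of_uncurry_left).aestronglyMeasurable.mul hm
  · filter_upwards [hf, ae_restrict_mem measurableSet_Ioo] with y hy hy01
    have h1 := abs_green_le h le_rfl (le_max_left 0 (β - 1)) (zero_add _) (x := x) (Or.inr rfl)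
      hx.1 hx.2 hy01.1 hy01.2.le
    rw [neg_zero, Real.rpow_zero, one_mul] at h1
    rw [norm_mul, Real.norm_eq_abs, Real.norm_eq_abs]
    calc |green β x y| * |f y| ≤ (|1 - β|⁻¹ * y ^ (-max 0 (β - 1))) * M :=
          mul_le_mul h1 hy (abs_nonneg _) ((abs_nonneg _).trans h1)
      _ = _ := by ring
  · filter_upwards [ae_restrict_mem measurableSet_Ioo] with y hy
    exact (continuousOn_green hy.1 h).mul continuousOn_const

theorem greenFun_one (f : ℝ → ℝ) : greenFun β f 1 = 0 := by
  refine (setIntegral_congr_fun measurableSet_Ioo fun y hy => ?_).trans (integral_zero ℝ ℝ)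
  simp only [green_one_left hy.2.le, zero_mul]

theorem greenFun_zero (hβ : β < 1) (f : ℝ → ℝ) : greenFun β f 0 = 0 := by
  refine (setIntegral_congr_fun measurableSet_Ioo fun y hy => ?_).trans (integral_zero ℝ ℝ)
  simp only [green_zero_left hβ hy.1.le, zero_mul]

end Degenerate

end

noncomputable section

/-! ## Regularity of solutions -/

namespace Degenerate

variable {β : ℝ} {f : ℝ → ℝ}

theorem hasDerivAt_primitive {g : ℝ → ℝ} (hi : IntervalIntegrable g volume 0 1)
    (hc : ContinuousOn g (Ioo 0 1)) {x : ℝ} (hx : x ∈ Ioo (0 : ℝ) 1) :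
    HasDerivAt (fun x => ∫ t in (0 : ℝ)..x, g t) (g x) x := by
  refine intervalIntegral.integral_hasDerivAt_right (hi.mono_set ?_)
    (hc.stronglyMeasurableAtFilter isOpen_Ioo x hx) (hc.continuousAt (Ioo_mem_nhds hx.1 hx.2))
  rw [uIcc_of_le hx.1.le, uIcc_of_le zero_le_one]
  exact Icc_subset_Icc_right hx.2.le

theorem intervalIntegrable_of_continuousOn (hf : ContinuousOn f (Icc 0 1)) :
    IntervalIntegrable f volume 0 1 := by
  refine ContinuousOn.intervalIntegrable ?_
  rwa [uIcc_of_le zero_le_one]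

theorem intervalIntegrable_potential_mul (hβ2 : β < 2) (hf : ContinuousOn f (Icc 0 1)) :
    IntervalIntegrable (fun y => potential β y * f y) volume 0 1 := by
  have h1 : IntervalIntegrable (potential β) volume 0 1 :=
    (intervalIntegrable_const.sub
      (intervalIntegral.intervalIntegrable_rpow' (by linarith))).div_const _
  refine h1.mul_continuousOn ?_
  rwa [uIcc_of_le zero_le_one]

theorem continuousOn_potential_mul (hf : ContinuousOn f (Icc 0 1)) :
    ContinuousOn (fun y => potential β y * f y) (Ioo 0 1) :=
  ContinuousOn.mul (fun _ hx => (continuousAt_potential (Or.inl hx.1.ne')).continuousWithinAt)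
    (hf.mono Ioo_subset_Icc_self)

/-- The flux of the solution `greenFun β f`. -/
def greenFlux (β : ℝ) (f : ℝ → ℝ) (x : ℝ) : ℝ :=
  coupling β * (∫ y in (0 : ℝ)..1, potential β y * f y) - ∫ y in (0 : ℝ)..x, f y

theorem continuousOn_greenFlux (hf : ContinuousOn f (Icc 0 1)) :
    ContinuousOn (greenFlux β f) (Icc 0 1) := by
  have h1 := intervalIntegral.continuousOn_primitive_interval (μ := volume) (f := f) (a := 0) (b := 1)
    (by rw [uIcc_of_le zero_le_one]; exact hf.integrableOn_Icc)
  rw [uIcc_of_le zero_le_one] at h1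
  exact continuousOn_const.sub h1

theorem hasDerivAt_greenFlux (hf : ContinuousOn f (Icc 0 1)) {x : ℝ} (hx : x ∈ Ioo (0 : ℝ) 1) :
    HasDerivAt (greenFlux β f) (-f x) x :=
  (hasDerivAt_primitive (intervalIntegrable_of_continuousOn hf) (hf.mono Ioo_subset_Icc_self)
    hx).const_sub _

/-- Splitting the integral at x, where max x y switches, removes x from the integrands, so that the
fundamental theorem of calculus applies. -/
theorem greenFun_eq (hβ2 : β < 2) (hf : ContinuousOn f (Icc 0 1)) {x : ℝ}
    (hx : x ∈ Ioo (0 : ℝ) 1) :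
    greenFun β f x = potential β x * (∫ y in (0 : ℝ)..x, f y)
      + ((∫ y in (0 : ℝ)..1, potential β y * f y) - ∫ y in (0 : ℝ)..x, potential β y * f y)
      - coupling β * potential β x * ∫ y in (0 : ℝ)..1, potential β y * f y := by
  have hx0 : x ∈ uIcc (0 : ℝ) 1 := by
    rw [uIcc_of_le zero_le_one]; exact ⟨hx.1.le, hx.2.le⟩
  have hq := intervalIntegrable_potential_mul hβ2 hf
  have hm : IntervalIntegrable (fun y => potential β (max x y) * f y) volume 0 1 := by
    refine intervalIntegrable_of_continuousOn (ContinuousOn.mul (Continuous.continuousOn ?_) hf)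
    refine continuous_iff_continuousAt.2 fun y => ?_
    exact ContinuousAt.comp (f := fun y => max x y) (continuousAt_potential
      (Or.inl (lt_max_of_lt_left hx.1).ne')) (by fun_prop)
  have h1 : greenFun β f x = (∫ y in (0 : ℝ)..1, potential β (max x y) * f y)
      - ∫ y in (0 : ℝ)..1, (coupling β * potential β x) * (potential β y * f y) := by
    rw [← intervalIntegral.integral_sub hm (hq.const_mul _), intervalIntegral.integral_of_le
      zero_le_one, integral_Ioc_eq_integral_Ioo]
    refine setIntegral_congr_fun measurableSet_Ioo fun y _ => ?_
    simp only [green]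
    ring
  have h2 : ∫ y in (0 : ℝ)..x, potential β (max x y) * f y
      = potential β x * ∫ y in (0 : ℝ)..x, f y := by
    rw [← intervalIntegral.integral_const_mul]
    refine intervalIntegral.integral_congr fun y hy => ?_
    rw [uIcc_of_le hx.1.le] at hy
    simp only [max_eq_left hy.2]
  have h3 : ∫ y in x..1, potential β (max x y) * f y = ∫ y in x..1, potential β y * f y := by
    refine intervalIntegral.integral_congr fun y hy => ?_
    rw [uIcc_of_le hx.2.le] at hy
    simp only [max_eq_right hy.1]
  have hl : uIcc 0 x ⊆ uIcc (0 : ℝ) 1 := uIcc_subset_uIcc left_mem_uIcc hx0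
  have hr : uIcc x 1 ⊆ uIcc (0 : ℝ) 1 := uIcc_subset_uIcc hx0 right_mem_uIcc
  rw [h1, ← intervalIntegral.integral_add_adjacent_intervals (hm.mono_set hl) (hm.mono_set hr), h2,
    h3, intervalIntegral.integral_const_mul,
    ← intervalIntegral.integral_add_adjacent_intervals (hq.mono_set hl) (hq.mono_set hr)]
  ring

/-- The terms ± `potential β x * f x` from the two primitives cancel; what remains carries the
factor x^(-β) from the derivative of the potential. -/
theorem hasDerivAt_greenFun (h : β ≠ 1) (hβ2 : β < 2) (hf : ContinuousOn f (Icc 0 1)) {x : ℝ}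
    (hx : x ∈ Ioo (0 : ℝ) 1) :
    HasDerivAt (greenFun β f) (x ^ (-β) * greenFlux β f x) x := by
  have h1 := hasDerivAt_potential h hx.1
  have h2 := hasDerivAt_primitive (intervalIntegrable_of_continuousOn hf)
    (hf.mono Ioo_subset_Icc_self) hx
  have h3 := hasDerivAt_primitive (intervalIntegrable_potential_mul hβ2 hf)
    (continuousOn_potential_mul hf) hx
  have h4 := ((h1.mul h2).add (h3.const_sub (∫ y in (0 : ℝ)..1, potential β y * f y))).sub
    ((h1.const_mul (coupling β)).mul_const (∫ y in (0 : ℝ)..1, potential β y * f y))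
  refine (h4.congr_of_eventuallyEq ?_).congr_deriv ?_
  · filter_upwards [Ioo_mem_nhds hx.1 hx.2] with y hy
    rw [greenFun_eq hβ2 hf hy]
    rfl
  · rw [greenFlux]
    ring

theorem rpow_mul_rpow_neg {x : ℝ} (hx : 0 < x) (β y : ℝ) : x ^ β * (x ^ (-β) * y) = y := by
  rw [← mul_assoc, ← Real.rpow_add hx, add_neg_cancel, Real.rpow_zero, one_mul]

theorem flux_greenFun (h : β ≠ 1) (hβ2 : β < 2) (hf : ContinuousOn f (Icc 0 1)) :
    EqOn (flux β (greenFun β f)) (greenFlux β f) (Ioo 0 1) := fun x hx => by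
  rw [flux, (hasDerivAt_greenFun h hβ2 hf hx).deriv, rpow_mul_rpow_neg hx.1]

theorem hasDerivAt_flux_greenFun (h : β ≠ 1) (hβ2 : β < 2) (hf : ContinuousOn f (Icc 0 1)) {x : ℝ}
    (hx : x ∈ Ioo (0 : ℝ) 1) : HasDerivAt (flux β (greenFun β f)) (-f x) x := by
  refine (hasDerivAt_greenFlux (β := β) hf hx).congr_of_eventuallyEq ?_
  filter_upwards [Ioo_mem_nhds hx.1 hx.2] with y hy using flux_greenFun h hβ2 hf hy

theorem diffExpr_greenFun (h : β ≠ 1) (hβ2 : β < 2) (hf : ContinuousOn f (Icc 0 1)) {x : ℝ}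
    (hx : x ∈ Ioo (0 : ℝ) 1) : diffExpr β (greenFun β f) x = f x := by
  rw [diffExpr, (hasDerivAt_flux_greenFun h hβ2 hf hx).deriv, neg_neg]

theorem exists_bound_of_continuousOn (hf : ContinuousOn f (Icc 0 1)) :
    ∃ M, ∀ x ∈ Icc (0 : ℝ) 1, |f x| ≤ M :=
  isCompact_Icc.exists_bound_of_continuousOn hf

theorem continuousOn_greenFun_of_continuousOn (h : β ≠ 1) (hβ2 : β < 2)
    (hf : ContinuousOn f (Icc 0 1)) : ContinuousOn (greenFun β f) (Icc 0 1) := by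
  obtain ⟨M, hM⟩ := exists_bound_of_continuousOn hf
  refine continuousOn_greenFun h hβ2
    ((hf.mono Ioo_subset_Icc_self).aestronglyMeasurable measurableSet_Ioo) (M := M) ?_
  filter_upwards [ae_restrict_mem measurableSet_Ioo] with y hy using hM y (Ioo_subset_Icc_self hy)

/-- The derivative of a solution is integrable. -/
theorem intervalIntegrable_deriv_greenFun (h : β ≠ 1) (hβ2 : β < 2)
    (hf : ContinuousOn f (Icc 0 1)) :
    IntervalIntegrable (fun x => x ^ (-β) * greenFlux β f x) volume 0 1 := by
  rcases lt_or_gt_of_ne h with hβ | hβ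
  · refine (intervalIntegral.intervalIntegrable_rpow' (by linarith)).mul_continuousOn ?_
    rw [uIcc_of_le zero_le_one]
    exact continuousOn_greenFlux hf
  -- For β > 1 the factor x^(-β) is not integrable, but the flux is at most M x near 0, which
  -- improves the exponent to 1 - β > -1.
  · obtain ⟨M, hM⟩ := exists_bound_of_continuousOn hf
    rw [intervalIntegrable_iff_integrableOn_Ioo_of_le zero_le_one]
    refine Integrable.mono' ((integrableOn_rpow_neg (s := β - 1) (by linarith)).const_mul M) ?_ ?_
    · refine ContinuousOn.aestronglyMeasurable ?_ measurableSet_Ioo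
      exact ContinuousOn.mul (fun x hx => (Real.continuousAt_rpow_const x _
        (Or.inl hx.1.ne')).continuousWithinAt) ((continuousOn_greenFlux hf).mono Ioo_subset_Icc_self)
    · filter_upwards [ae_restrict_mem measurableSet_Ioo] with x hx
      have h1 : |greenFlux β f x| ≤ M * x := by
        rw [greenFlux, coupling_of_gt hβ, zero_mul, zero_sub, abs_neg]
        have := intervalIntegral.norm_integral_le_of_norm_le_const (a := 0) (b := x) (f := f) (C := M)
          fun y hy => by
            rw [uIoc_of_le hx.1.le] at hy
            exact hM y ⟨hy.1.le, hy.2.trans hx.2.le⟩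
        rwa [sub_zero, abs_of_pos hx.1] at this
      have h2 : x ^ (-(β - 1)) = x ^ (-β) * x := by
        rw [show -(β - 1) = -β + 1 by ring, Real.rpow_add hx.1, Real.rpow_one]
      rw [norm_mul, Real.norm_eq_abs, Real.norm_eq_abs, abs_of_nonneg (Real.rpow_nonneg hx.1.le _),
        h2]
      calc x ^ (-β) * |greenFlux β f x| ≤ x ^ (-β) * (M * x) :=
            mul_le_mul_of_nonneg_left h1 (Real.rpow_nonneg hx.1.le _)
        _ = _ := by ring

/-- Solutions with continuous right-hand side are absolutely continuous. -/
theorem exists_absolutelyContinuous_greenFun (h : β ≠ 1) (hβ2 : β < 2)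
    (hf : ContinuousOn f (Icc 0 1)) :
    ∃ g : ℝ → ℝ, AbsolutelyContinuousOnInterval g 0 1 ∧ EqOn g (greenFun β f) (Ioo 0 1) := by
  have hi := intervalIntegrable_deriv_greenFun h hβ2 hf
  -- The primitive is based at 1, where the solution vanishes, so no constant has to be added.
  refine ⟨_, hi.absolutelyContinuousOnInterval_intervalIntegral (c := 1) right_mem_uIcc,
    fun x hx => ?_⟩
  have hsub : Icc x 1 ⊆ Icc 0 1 := Icc_subset_Icc_left hx.1.le
  have := intervalIntegral.integral_eq_sub_of_hasDerivAt_of_le hx.2.le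
    ((continuousOn_greenFun_of_continuousOn h hβ2 hf).mono hsub)
    (fun y hy => hasDerivAt_greenFun h hβ2 hf ⟨hx.1.trans hy.1, hy.2⟩)
    (hi.mono_set (by rwa [uIcc_of_le hx.2.le, uIcc_of_le zero_le_one]))
  rw [greenFun_one, zero_sub] at this
  simp only [intervalIntegral.integral_symm x 1, this, neg_neg]

theorem inDomain_greenFun (h : β ≠ 1) (hβ2 : β < 2) (hf : ContinuousOn f (Icc 0 1)) {g : ℝ → ℝ}
    (hg : AbsolutelyContinuousOnInterval g 0 1) (hgf : EqOn g f (Ioo 0 1)) :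
    InDomain β (greenFun β f) where
  continuousOn := continuousOn_greenFun_of_continuousOn h hβ2 hf
  differentiableAt _ hx := (hasDerivAt_greenFun h hβ2 hf hx).differentiableAt
  flux_continuous := ⟨greenFlux β f, continuousOn_greenFlux hf, (flux_greenFun h hβ2 hf).symm⟩
  deriv_flux := ⟨fun x => -g x, hg.neg, fun x hx => by
    simp only [hgf hx]; exact hasDerivAt_flux_greenFun h hβ2 hf hx⟩
  right_boundary := greenFun_one f
  left_boundary hβ := greenFun_zero hβ f

/-! ### Uniqueness for the boundary value problem -/

theorem eqOn_const_of_hasDerivAt_zero {u : ℝ → ℝ} (hu : ∀ x ∈ Ioo (0 : ℝ) 1, HasDerivAt u 0 x) :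
    ∃ c, EqOn u (fun _ => c) (Ioo 0 1) := by
  obtain ⟨c, hc⟩ := isOpen_Ioo.exists_is_const_of_deriv_eq_zero isPreconnected_Ioo
    (fun x hx => (hu x hx).differentiableAt.differentiableWithinAt) (fun x hx => (hu x hx).deriv)
  exact ⟨c, hc⟩

/-- The homogeneous problem has only the trivial solution. -/
theorem InDomain.eqOn_zero (h : β ≠ 1) {v : ℝ → ℝ} (hv : InDomain β v)
    (h0 : ∀ x ∈ Ioo (0 : ℝ) 1, diffExpr β v x = 0) : EqOn v 0 (Ioo 0 1) := by
  obtain ⟨g, -, hd⟩ := hv.deriv_flux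
  obtain ⟨c, hc⟩ := eqOn_const_of_hasDerivAt_zero (u := flux β v) fun x hx => by
    refine (hd x hx).congr_deriv ?_
    have := h0 x hx
    rwa [diffExpr, (hd x hx).deriv, neg_eq_zero] at this
  -- Constant flux c makes v + c q constant; the condition at 1 makes that constant zero, so v = -c
  -- q.
  obtain ⟨k, hk⟩ := eqOn_const_of_hasDerivAt_zero (u := fun x => v x + c * potential β x)
    fun x hx => by
      refine ((hv.differentiableAt x hx).hasDerivAt.add
        ((hasDerivAt_potential h hx.1).const_mul c)).congr_deriv ?_
      have h1 : x ^ β * deriv v x = c := hc hx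
      rw [← h1, mul_neg, mul_assoc, mul_comm (deriv v x), rpow_mul_rpow_neg hx.1, add_neg_cancel]
  have hone : Tendsto (fun x => v x + c * potential β x) (𝓝[<] 1) (𝓝 0) := by
    have h1 : Tendsto v (𝓝[<] 1) (𝓝 (v 1)) :=
      (hv.continuousOn 1 (right_mem_Icc.2 zero_le_one)).mono_of_mem_nhdsWithin
        (Icc_mem_nhdsLT zero_lt_one)
    have h2 : Tendsto (potential β) (𝓝[<] 1) (𝓝 (potential β 1)) :=
      (continuousAt_potential (Or.inl one_ne_zero)).continuousWithinAt
    have h3 := h1.add (h2.const_mul c)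
    rwa [hv.right_boundary, potential_one, mul_zero, add_zero] at h3
  have hk0 : k = 0 := by
    refine tendsto_nhds_unique (tendsto_const_nhds.congr' ?_) hone
    filter_upwards [Ioo_mem_nhdsLT zero_lt_one] with x hx using (hk hx).symm
  have hc0 : c = 0 := by
    rcases lt_or_gt_of_ne h with hβ | hβ
    · have h1 : Tendsto v (𝓝[>] 0) (𝓝 (v 0)) :=
        (hv.continuousOn 0 (left_mem_Icc.2 zero_le_one)).mono_of_mem_nhdsWithin
          (Icc_mem_nhdsGT zero_lt_one)
      have h2 : Tendsto (potential β) (𝓝[>] 0) (𝓝 (potential β 0)) :=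
        (continuousAt_potential (Or.inr hβ)).continuousWithinAt
      have h3 := h1.add (h2.const_mul c)
      rw [hv.left_boundary hβ, zero_add, potential_zero h] at h3
      have h4 : c * (1 - β)⁻¹ = 0 := by
        refine tendsto_nhds_unique h3 ((tendsto_const_nhds (x := (0 : ℝ))).congr' ?_)
        filter_upwards [Ioo_mem_nhdsGT zero_lt_one] with x hx
        rw [← hk0]
        exact (hk hx).symm
      exact (mul_eq_zero.1 h4).resolve_right (inv_ne_zero (sub_ne_zero.2 h.symm))
    -- For β > 1 no boundary condition is left at 0: continuity of v there excludes a nonzero flux,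
    -- by `flux_zero_le` for v and -v.
    · have h1 : c ≤ 0 := flux_zero_le (w := fun _ => c) hβ.le hv.continuousOn hv.differentiableAt
        continuousOn_const hc.symm
      have hn := hv.smul (-1)
      have h2 : -c ≤ 0 := flux_zero_le (w := fun _ => -c) hβ.le hn.continuousOn
        hn.differentiableAt continuousOn_const fun x hx => by
          rw [flux_smul, hc hx]; ring
      linarith
  intro x hx
  have := hk hx
  simpa [hk0, hc0] using this

/-- Every function in the domain is the solution belonging to its image. -/
theorem InDomain.eqOn_greenFun (h : β ≠ 1) (hβ2 : β < 2) {v : ℝ → ℝ} (hv : InDomain β v) :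
    EqOn v (greenFun β (diffExpr β v)) (Ioo 0 1) := by
  obtain ⟨g, hg, hd⟩ := hv.deriv_flux
  have hgc : ContinuousOn (fun x => -g x) (Icc 0 1) := by
    have := hg.continuousOn
    rw [uIcc_of_le zero_le_one] at this
    exact this.neg
  have hdv : EqOn (diffExpr β v) (fun x => -g x) (Ioo 0 1) := fun x hx => by
    rw [diffExpr, (hd x hx).deriv]
  have heq : greenFun β (diffExpr β v) = greenFun β fun x => -g x :=
    KernelOperator.kernelFun_congr_ae (by
      filter_upwards [ae_restrict_mem measurableSet_Ioo] with x hx using hdv hx)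
  have hu := inDomain_greenFun h hβ2 hgc hg.neg (fun _ _ => rfl)
  have hz := (hv.add (hu.smul (-1))).eqOn_zero h fun x hx => by
    rw [hv.diffExpr_add (hu.smul (-1)) hx, hu.diffExpr_smul _ hx, hdv hx,
      diffExpr_greenFun h hβ2 hgc hx]
    ring
  intro x hx
  have := hz hx
  rw [heq]
  simp only [Pi.add_apply, Pi.smul_apply, smul_eq_mul, Pi.zero_apply] at this
  linarith

end Degenerate

end

noncomputable section

/-! ## The solution operator on `L²(0, 1)` -/

namespace Degenerate

variable {β : ℝ}

/-- A square integrable function `h` for which `h x * h y` dominates Green's function. -/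
def greenMajorant (β x : ℝ) : ℝ := √|1 - β|⁻¹ * x ^ (-(max 0 (β - 1) / 2))

theorem measurable_greenMajorant : Measurable (greenMajorant β) := by
  unfold greenMajorant; fun_prop

theorem memLp_greenMajorant (hβ2 : β < 2) :
    MemLp (greenMajorant β) 2 (volume.restrict (Ioo (0 : ℝ) 1)) := by
  rw [memLp_two_iff_integrable_sq measurable_greenMajorant.aestronglyMeasurable]
  refine ((integrableOn_rpow_neg (max_lt one_pos (by linarith : β - 1 < 1))).const_mul
    |1 - β|⁻¹).congr ?_
  filter_upwards [ae_restrict_mem measurableSet_Ioo] with x hx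
  rw [greenMajorant, mul_pow, Real.sq_sqrt (by positivity), ← Real.rpow_natCast,
    ← Real.rpow_mul hx.1.le]
  congr 2
  push_cast
  ring

theorem ae_abs_green_le (h : β ≠ 1) : ∀ᵐ x ∂volume.restrict (Ioo (0 : ℝ) 1),
    ∀ᵐ y ∂volume.restrict (Ioo (0 : ℝ) 1),
      |green β x y| ≤ greenMajorant β x * greenMajorant β y := by
  filter_upwards [ae_restrict_mem measurableSet_Ioo] with x hx
  filter_upwards [ae_restrict_mem measurableSet_Ioo] with y hy
  -- The exponent is split evenly, a = b, which makes the majorant the same function of x and of y.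
  have h0 : (0 : ℝ) ≤ max 0 (β - 1) / 2 := div_nonneg (le_max_left _ _) two_pos.le
  refine (abs_green_le h h0 h0 (add_halves _) (Or.inl hx.1) hx.1.le hx.2.le hy.1 hy.2.le).trans
    (le_of_eq ?_)
  rw [greenMajorant, greenMajorant, mul_mul_mul_comm, Real.mul_self_sqrt (by positivity)]

/-- The solution operator of `-(x ^ β u')' = f` on `L²(0, 1)`. -/
def greenOperator (h : β ≠ 1) (hβ2 : β < 2) : L2 →L[ℝ] L2 :=
  KernelOperator.operator measurable_green (memLp_greenMajorant hβ2) (ae_abs_green_le h)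

theorem greenOperator_ae (h : β ≠ 1) (hβ2 : β < 2) (f : L2) :
    greenOperator h hβ2 f =ᵐ[volume.restrict (Ioo (0 : ℝ) 1)] greenFun β f :=
  KernelOperator.operator_apply_ae _ _ _ f

theorem isSymmetric_greenOperator (h : β ≠ 1) (hβ2 : β < 2) :
    (greenOperator h hβ2 : L2 →ₗ[ℝ] L2).IsSymmetric :=
  KernelOperator.isSymmetric_operator _ _ _ measurable_greenMajorant green_comm

theorem greenOperator_operator (h : β ≠ 1) (hβ2 : β < 2) (x : (operator β).domain) :
    greenOperator h hβ2 (operator β x) = x := by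
  have hmem : ((x : L2), operator β x) ∈ graph β := by
    rw [← operator_graph]; exact LinearPMap.mem_graph _ x
  obtain ⟨v, hv, h₁, h₂⟩ := hmem
  refine Lp.ext ((greenOperator_ae h hβ2 _).trans ?_)
  have heq : greenFun β (operator β x) = greenFun β (diffExpr β v) :=
    KernelOperator.kernelFun_congr_ae h₂
  filter_upwards [h₁, ae_restrict_mem measurableSet_Ioo] with y hy hy01
  rw [hy, heq, hv.eqOn_greenFun h hβ2 hy01]

/-! ### Density -/

/-- A subspace of `L²(0, 1)` containing all test functions is dense. -/
theorem dense_of_contDiff_mem {S : Submodule ℝ L2}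
    (hS : ∀ φ : ℝ → ℝ, ContDiff ℝ (⊤ : ℕ∞) φ → HasCompactSupport φ → tsupport φ ⊆ Ioo 0 1 →
      ∃ f ∈ S, f =ᵐ[volume.restrict (Ioo (0 : ℝ) 1)] φ) : Dense (S : Set L2) := by
  rw [Submodule.dense_iff_topologicalClosure_eq_top, Submodule.topologicalClosure_eq_top_iff,
    Submodule.eq_bot_iff]
  intro f hf
  have hint : IntegrableOn f (Ioo 0 1) := (Lp.memLp f).integrable one_le_two
  have := isOpen_Ioo.ae_eq_zero_of_integral_contDiff_smul_eq_zero hint.locallyIntegrableOn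
    fun φ h1 h2 h3 => by
      obtain ⟨g, hg, hgφ⟩ := hS φ h1 h2 h3
      have h0 := (Submodule.mem_orthogonal S f).1 hf g hg
      rw [L2.inner_def] at h0
      rw [← setIntegral_eq_integral_of_forall_compl_eq_zero (s := Ioo (0 : ℝ) 1)
        fun x hx => by rw [image_eq_zero_of_notMem_tsupport fun h => hx (h3 h), zero_smul]]
      refine Eq.trans (integral_congr_ae ?_) h0
      filter_upwards [hgφ] with x hx
      rw [hx]
      simp [mul_comm]
  refine Lp.ext (EventuallyEq.trans ?_ (Lp.coeFn_zero _ _ _).symm)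
  exact (ae_restrict_iff' measurableSet_Ioo).2 this

theorem memLp_of_continuousOn {f : ℝ → ℝ} (hf : ContinuousOn f (Icc 0 1)) :
    MemLp f 2 (volume.restrict (Ioo (0 : ℝ) 1)) := by
  obtain ⟨M, hM⟩ := exists_bound_of_continuousOn hf
  refine MemLp.of_bound ((hf.mono Ioo_subset_Icc_self).aestronglyMeasurable measurableSet_Ioo) M ?_
  filter_upwards [ae_restrict_mem measurableSet_Ioo] with y hy using hM y (Ioo_subset_Icc_self hy)

/-- Functions in D(A) have an absolutely continuous image under A, so Green's operator does not map
all of L² into D(A); right-hand sides that are test functions suffice. -/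
theorem dense_greenOperator_mem_graph (h : β ≠ 1) (hβ2 : β < 2) :
    Dense {f : L2 | (greenOperator h hβ2 f, f) ∈ (operator β).graph} := by
  rw [operator_graph]
  refine dense_of_contDiff_mem
    (S := (graph β).comap ((greenOperator h hβ2 : L2 →ₗ[ℝ] L2).prod LinearMap.id))
    fun φ hφ _ _ => ?_
  have hc : ContinuousOn φ (Icc 0 1) := hφ.continuous.continuousOn
  have hm := memLp_of_continuousOn hc
  refine ⟨hm.toLp, ?_, hm.coeFn_toLp⟩
  have hac : AbsolutelyContinuousOnInterval φ 0 1 :=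
    (hφ.of_le (by exact_mod_cast le_top)).contDiffOn.absolutelyContinuousOnInterval
  refine ⟨greenFun β φ, inDomain_greenFun h hβ2 hc hac (fun _ _ => rfl), ?_, ?_⟩
  · refine (greenOperator_ae h hβ2 _).trans (EventuallyEq.of_eq ?_)
    exact KernelOperator.kernelFun_congr_ae hm.coeFn_toLp
  · refine hm.coeFn_toLp.trans ?_
    filter_upwards [ae_restrict_mem measurableSet_Ioo] with x hx
    rw [diffExpr_greenFun h hβ2 hc hx]

/-- The power x^β is smooth away from 0, and the derivative of φ vanishes near 0. -/
theorem contDiff_flux {φ : ℝ → ℝ} (hφ : ContDiff ℝ (⊤ : ℕ∞) φ) (hs : tsupport φ ⊆ Ioo 0 1) :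
    ContDiff ℝ (⊤ : ℕ∞) (flux β φ) := by
  refine contDiff_iff_contDiffAt.2 fun x => ?_
  by_cases hx : x ∈ tsupport (deriv φ)
  · have h1 : ContDiffAt ℝ (⊤ : ℕ∞) (fun x : ℝ => x ^ β) x :=
      Real.contDiffAt_rpow_const_of_ne (hs (tsupport_deriv_subset hx)).1.ne'
    have h2 : ContDiff ℝ (⊤ : ℕ∞) (deriv φ) := (contDiff_infty_iff_deriv.1 hφ).2
    exact h1.mul h2.contDiffAt
  · refine (contDiffAt_const (c := (0 : ℝ))).congr_of_eventuallyEq ?_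
    filter_upwards [notMem_tsupport_iff_eventuallyEq.1 hx] with y hy
    rw [flux, hy, Pi.zero_apply, mul_zero]

theorem inDomain_of_contDiff {φ : ℝ → ℝ} (hφ : ContDiff ℝ (⊤ : ℕ∞) φ)
    (hs : tsupport φ ⊆ Ioo 0 1) : InDomain β φ where
  continuousOn := hφ.continuous.continuousOn
  differentiableAt x _ := (hφ.differentiable (by simp)).differentiableAt
  flux_continuous := ⟨flux β φ, (contDiff_flux hφ hs).continuous.continuousOn, fun _ _ => rfl⟩
  deriv_flux := ⟨deriv (flux β φ),
    ((contDiff_infty_iff_deriv.1 (contDiff_flux hφ hs)).2.of_le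
      (by exact_mod_cast le_top)).contDiffOn.absolutelyContinuousOnInterval,
    fun x _ => ((contDiff_flux hφ hs).differentiable (by simp)).differentiableAt.hasDerivAt⟩
  right_boundary := image_eq_zero_of_notMem_tsupport fun h => lt_irrefl _ (hs h).2
  left_boundary _ := image_eq_zero_of_notMem_tsupport fun h => lt_irrefl _ (hs h).1

theorem dense_domain_operator : Dense ((operator β).domain : Set L2) := by
  refine dense_of_contDiff_mem fun φ hφ _ hs => ?_
  have hm := memLp_of_continuousOn (f := φ) hφ.continuous.continuousOn
  have hd : Continuous (diffExpr β φ) :=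
    (contDiff_infty_iff_deriv.1 (contDiff_flux hφ hs)).2.continuous.neg
  have hm' := memLp_of_continuousOn hd.continuousOn
  refine ⟨hm.toLp, ?_, hm.coeFn_toLp⟩
  refine LinearPMap.mem_domain_of_mem_graph (y := hm'.toLp) ?_
  rw [operator_graph]
  exact ⟨φ, inDomain_of_contDiff hφ hs, hm.coeFn_toLp, hm'.coeFn_toLp⟩

theorem not_finiteDimensional_L2 : ¬ FiniteDimensional ℝ L2 := by
  intro hfin
  -- Disjoint intervals of positive length: their indicators form an infinite orthogonal family.
  set s : ℕ → Set ℝ := fun n => Ioo (1 / ((n : ℝ) + 2)) (1 / ((n : ℝ) + 1)) with hs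
  have hpos : ∀ n : ℕ, (0 : ℝ) < (n : ℝ) + 1 := fun n => by positivity
  have hsub : ∀ n, s n ⊆ Ioo 0 1 := fun n x hx => by
    refine ⟨lt_trans (by positivity) hx.1, hx.2.trans_le ?_⟩
    rw [div_le_one (hpos n)]
    linarith [(Nat.cast_nonneg n : (0 : ℝ) ≤ n)]
  have hdisj : ∀ m n, m < n → s m ∩ s n = ∅ := fun m n hmn => by
    refine eq_empty_of_forall_notMem fun x hx => ?_
    have h1 := hx.1.1
    have h2 := hx.2.2
    have h3 : (m : ℝ) + 2 ≤ (n : ℝ) + 1 := by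
      have : ((m + 1 : ℕ) : ℝ) ≤ n := by exact_mod_cast hmn
      push_cast at this
      linarith
    have h4 : 1 / ((n : ℝ) + 1) ≤ 1 / ((m : ℝ) + 2) :=
      one_div_le_one_div_of_le (by positivity) h3
    linarith
  have hinner : ∀ m n, inner ℝ (indicatorConstLp 2 (measurableSet_Ioo : MeasurableSet (s m))
      (measure_ne_top (volume.restrict (Ioo (0 : ℝ) 1)) (s m)) (1 : ℝ))
      (indicatorConstLp 2 (measurableSet_Ioo : MeasurableSet (s n))
      (measure_ne_top (volume.restrict (Ioo (0 : ℝ) 1)) (s n)) (1 : ℝ))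
      = (volume.restrict (Ioo (0 : ℝ) 1)).real (s m ∩ s n) := fun m n =>
    L2.real_inner_indicatorConstLp_one_indicatorConstLp_one _ _ _ _
  have hli := linearIndependent_of_ne_zero_of_inner_eq_zero (𝕜 := ℝ)
    (v := fun n => indicatorConstLp 2 (measurableSet_Ioo : MeasurableSet (s n))
      (measure_ne_top (volume.restrict (Ioo (0 : ℝ) 1)) (s n)) (1 : ℝ)) (fun n hn => ?_)
    (fun m n hmn => ?_)
  · have := hli.finite_of_isNoetherian
    exact not_finite ℕ
  · have h1 := hinner n n
    rw [hn, inner_zero_left, inter_self, measureReal_restrict_apply measurableSet_Ioo,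
      inter_eq_left.2 (hsub n), hs, Real.volume_real_Ioo] at h1
    have h2 : 1 / ((n : ℝ) + 2) < 1 / ((n : ℝ) + 1) :=
      one_div_lt_one_div_of_lt (hpos n) (by linarith)
    have := le_max_left (1 / ((n : ℝ) + 1) - 1 / ((n : ℝ) + 2)) 0
    linarith
  · refine (hinner m n).trans ?_
    rcases lt_or_gt_of_ne hmn with h | h
    · rw [hdisj m n h, measureReal_empty]
    · rw [inter_comm, hdisj n m h, measureReal_empty]

theorem isBoundedInverse_greenOperator (h : β ≠ 1) (hβ2 : β < 2) :
    (friedrichs β).IsBoundedInverse (greenOperator h hβ2) :=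
  LinearPMap.isBoundedInverse_friedrichsExtension _ dense_domain_operator
    (isSymmetric_greenOperator h hβ2) (greenOperator_operator h hβ2)
    (dense_greenOperator_mem_graph h hβ2)

/-! ### Eigenfunctions -/

/-- Eigenfunctions of the solution operator are essentially bounded. -/
theorem exists_ae_abs_le_of_eigen (hβ0 : 0 < β) (h : β ≠ 1) (hβ2 : β < 2) {b : L2} {lam : ℝ}
    (hb : b = lam • greenOperator h hβ2 b) :
    ∃ M, ∀ᵐ y ∂volume.restrict (Ioo (0 : ℝ) 1), |b y| ≤ M := by
  have hbae : b =ᵐ[volume.restrict (Ioo (0 : ℝ) 1)] fun x => lam * greenFun β b x := by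
    nth_rw 1 [hb]
    filter_upwards [Lp.coeFn_smul lam (greenOperator h hβ2 b), greenOperator_ae h hβ2 b]
      with x h1 h2
    rw [h1, Pi.smul_apply, h2, smul_eq_mul]
  set e := max 0 (β - 1) with he
  have he0 : 0 ≤ e := le_max_left _ _
  -- The gain per step is (2 - β)/2, chosen so that e plus the gain stays below 1. For e = 0 this
  -- needs β > 0, for e = β - 1 it needs β < 2.
  have hed : e + (2 - β) / 2 < 1 := by
    rw [he, ← lt_sub_iff_add_lt]
    exact max_lt (by linarith) (by linarith)
  -- Bootstrap: Cauchy–Schwarz with the L² majorant gives the exponent e/2, and each use of b = λ K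
  -- b lowers it by the gain until it reaches 0.
  have key : ∀ k : ℕ, ∃ C, ∀ᵐ y ∂volume.restrict (Ioo (0 : ℝ) 1),
      |b y| ≤ C * y ^ (-max 0 (e / 2 - k * ((2 - β) / 2))) := by
    intro k
    induction k with
    | zero =>
      refine ⟨|lam| * (√|1 - β|⁻¹ * ‖(memLp_greenMajorant hβ2).toLp‖ * ‖b‖), ?_⟩
      filter_upwards [hbae, ae_restrict_mem measurableSet_Ioo,
        KernelOperator.ae_exists_section measurable_green (memLp_greenMajorant hβ2)
          (ae_abs_green_le h)] with y h1 h2 ⟨κ, h3, h4⟩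
      have h5 : ‖greenMajorant β y‖ = √|1 - β|⁻¹ * y ^ (-(e / 2)) := by
        rw [Real.norm_eq_abs, greenMajorant, abs_of_nonneg]
        exact mul_nonneg (Real.sqrt_nonneg _) (Real.rpow_nonneg h2.1.le _)
      rw [Nat.cast_zero, zero_mul, sub_zero, max_eq_right (by positivity), h1, abs_mul, greenFun,
        h4 b, mul_assoc]
      refine mul_le_mul_of_nonneg_left ?_ (abs_nonneg _)
      rw [h5] at h3
      calc |inner ℝ κ b| ≤ ‖κ‖ * ‖b‖ := abs_real_inner_le_norm _ _
        _ ≤ (√|1 - β|⁻¹ * y ^ (-(e / 2)) * ‖(memLp_greenMajorant hβ2).toLp‖) * ‖b‖ := by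
          gcongr
        _ = _ := by ring
    | succ k ih =>
      obtain ⟨C, hC⟩ := ih
      set s := max 0 (e / 2 - k * ((2 - β) / 2)) with hs
      set a := max 0 (e / 2 - ((k + 1 : ℕ) : ℝ) * ((2 - β) / 2)) with ha
      have hk : (0 : ℝ) ≤ ((k + 1 : ℕ) : ℝ) * ((2 - β) / 2) :=
        mul_nonneg (Nat.cast_nonneg _) (by linarith)
      have hae : a ≤ e := max_le he0 (by linarith)
      have hsa : s ≤ a + (2 - β) / 2 := by
        have h1 : e / 2 - ((k + 1 : ℕ) : ℝ) * ((2 - β) / 2) ≤ a := le_max_right _ _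
        have h2 : 0 ≤ a := le_max_left _ _
        refine max_le (by linarith) ?_
        push_cast at h1
        linarith
      -- Green's function is split with exponent a on x, the new bound, and e - a on y; the
      -- y-integral converges since e - a + s ≤ e + (2 - β)/2 < 1.
      obtain ⟨C', hC'⟩ := exists_abs_greenFun_le h (le_max_left _ _ : 0 ≤ a) (sub_nonneg.2 hae)
        (add_sub_cancel a e) (by linarith : e - a + s < 1) hC
      refine ⟨|lam| * C', ?_⟩
      filter_upwards [hbae, ae_restrict_mem measurableSet_Ioo] with y h1 h2
      rw [h1, abs_mul, mul_assoc]
      exact mul_le_mul_of_nonneg_left (hC' y h2) (abs_nonneg _)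
  obtain ⟨k, hk⟩ := exists_nat_ge ((e / 2) / ((2 - β) / 2))
  obtain ⟨C, hC⟩ := key k
  rw [div_le_iff₀ (by linarith)] at hk
  rw [max_eq_left (by linarith)] at hC
  exact ⟨C, hC.mono fun y hy => by simpa using hy⟩

/-- The continuous representative of an eigenfunction of the solution operator. -/
theorem eigenfunction_regularity (hβ0 : 0 < β) (h : β ≠ 1) (hβ2 : β < 2) {b : L2} {lam : ℝ}
    (hb : b = lam • greenOperator h hβ2 b) :
    ∃ v : ℝ → ℝ, ContinuousOn v (Icc 0 1) ∧ b =ᵐ[volume.restrict (Ioo (0 : ℝ) 1)] v ∧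
      v = greenFun β (fun x => lam * v x) := by
  obtain ⟨M, hM⟩ := exists_ae_abs_le_of_eigen hβ0 h hβ2 hb
  have hbv : b =ᵐ[volume.restrict (Ioo (0 : ℝ) 1)] fun x => lam * greenFun β b x := by
    nth_rw 1 [hb]
    filter_upwards [Lp.coeFn_smul lam (greenOperator h hβ2 b), greenOperator_ae h hβ2 b]
      with x h1 h2
    rw [h1, Pi.smul_apply, h2, smul_eq_mul]
  -- The integral operator depends only on the class of b, so the right-hand side defines a
  -- representative that satisfies the integral equation at every point.
  refine ⟨fun x => lam * greenFun β b x, continuousOn_const.mul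
    (continuousOn_greenFun h hβ2 (Lp.aestronglyMeasurable b) hM), hbv, ?_⟩
  have h1 : greenFun β (fun x => lam * (lam * greenFun β b x)) = greenFun β (fun x => lam * b x) :=
    KernelOperator.kernelFun_congr_ae (hbv.mono fun x hx => by simp only [← hx])
  rw [h1]
  funext x
  simp only [greenFun, KernelOperator.kernelFun]
  rw [← integral_const_mul]
  exact integral_congr_ae (Eventually.of_forall fun y => by ring)

/-- Since v solves the problem with the continuous right-hand side lam * v, it agrees on (0, 1) with
an absolutely continuous function; this makes lam * v an admissible right-hand side for D(A). -/
theorem inDomain_of_eigen (h : β ≠ 1) (hβ2 : β < 2) {v : ℝ → ℝ} {lam : ℝ}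
    (hc : ContinuousOn v (Icc 0 1)) (hv : v = greenFun β (fun x => lam * v x)) :
    InDomain β v ∧ ∀ x ∈ Ioo (0 : ℝ) 1, diffExpr β v x = lam * v x := by
  have hf : ContinuousOn (fun x => lam * v x) (Icc 0 1) := continuousOn_const.mul hc
  obtain ⟨g, hg, hgv⟩ := exists_absolutelyContinuous_greenFun h hβ2 hf
  rw [← hv] at hgv
  have h1 := inDomain_greenFun h hβ2 hf (hg.const_mul lam)
    (fun x hx => congrArg (lam * ·) (hgv hx))
  have h2 := fun x (hx : x ∈ Ioo (0 : ℝ) 1) => diffExpr_greenFun h hβ2 hf hx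
  rw [← hv] at h1 h2
  exact ⟨h1, h2⟩

/-- Green's formula for solutions. -/
theorem integral_flux_mul_deriv (h : β ≠ 1) (hβ2 : β < 2) {f g : ℝ → ℝ}
    (hf : ContinuousOn f (Icc 0 1)) (hg : ContinuousOn g (Icc 0 1)) :
    IntegrableOn (fun x => x ^ β * deriv (greenFun β f) x * deriv (greenFun β g) x) (Ioo 0 1) ∧
      ∫ x in Ioo (0 : ℝ) 1, x ^ β * deriv (greenFun β f) x * deriv (greenFun β g) x
        = ∫ x in Ioo (0 : ℝ) 1, f x * greenFun β g x := by
  have heq : EqOn (fun x => x ^ β * deriv (greenFun β f) x * deriv (greenFun β g) x)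
      (fun x => greenFlux β f x * (x ^ (-β) * greenFlux β g x)) (Ioo 0 1) := fun x hx => by
    have h1 := flux_greenFun h hβ2 hf hx
    rw [flux] at h1
    simp only [h1, (hasDerivAt_greenFun h hβ2 hg hx).deriv]
  have hi : IntervalIntegrable (fun x => greenFlux β f x * (x ^ (-β) * greenFlux β g x))
      volume 0 1 := by
    refine (intervalIntegrable_deriv_greenFun h hβ2 hg).continuousOn_mul ?_
    rw [uIcc_of_le zero_le_one]
    exact continuousOn_greenFlux hf
  have hgc := continuousOn_greenFun_of_continuousOn h hβ2 hg
  have hfi : IntervalIntegrable (fun x => f x * greenFun β g x) volume 0 1 :=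
    intervalIntegrable_of_continuousOn (hf.mul hgc)
  refine ⟨((intervalIntegrable_iff_integrableOn_Ioo_of_le zero_le_one).1 hi).congr_fun heq.symm
    measurableSet_Ioo, ?_⟩
  -- Integrate the derivative of the flux of `greenFun β f` times `greenFun β g`.
  have hftc := intervalIntegral.integral_eq_sub_of_hasDerivAt_of_le zero_le_one
    ((continuousOn_greenFlux (β := β) hf).mul hgc)
    (fun x hx => (hasDerivAt_greenFlux hf hx).mul (hasDerivAt_greenFun h hβ2 hg hx))
    ((hfi.neg.add hi).congr fun x _ => by simp)
  -- At 0 the solution vanishes if β < 1, and the flux vanishes if β > 1.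
  have h0 : greenFlux β f 0 * greenFun β g 0 = 0 := by
    rcases lt_or_gt_of_ne h with hβ | hβ
    · rw [greenFun_zero hβ, mul_zero]
    · rw [greenFlux, coupling_of_gt hβ, intervalIntegral.integral_same]; ring
  have hsplit : ∫ x in (0 : ℝ)..1, (-f x * greenFun β g x
      + greenFlux β f x * (x ^ (-β) * greenFlux β g x))
      = -(∫ x in (0 : ℝ)..1, f x * greenFun β g x)
        + ∫ x in (0 : ℝ)..1, greenFlux β f x * (x ^ (-β) * greenFlux β g x) := by
    rw [← intervalIntegral.integral_neg]
    refine Eq.trans ?_ (intervalIntegral.integral_add hfi.neg hi)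
    simp only [neg_mul]
  simp only [Pi.mul_apply, greenFun_one, mul_zero, h0, sub_zero] at hftc
  rw [hsplit] at hftc
  rw [setIntegral_congr_fun measurableSet_Ioo heq, ← integral_Ioc_eq_integral_Ioo,
    ← integral_Ioc_eq_integral_Ioo, ← intervalIntegral.integral_of_le zero_le_one,
    ← intervalIntegral.integral_of_le zero_le_one]
  linarith

end Degenerate

end

/-! ### Spectral decomposition of the Friedrichs extension -/

theorem mainTheorem3 (β : ℝ) (hβ0 : 0 < β) (hβ2 : β < 2) (hβ1 : β ≠ 1) :
    (Degenerate.friedrichs β).HasDiscreteSpectrum ∧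
    ∃ (lam : ℕ → ℝ) (v : ℕ → ℝ → ℝ) (b : HilbertBasis ℕ ℝ Degenerate.L2),
      (∀ n, 0 < lam n) ∧
      Tendsto lam atTop atTop ∧
      (Degenerate.friedrichs β).spectrum = Set.range lam ∧
      (∀ n, b n =ᵐ[volume.restrict (Ioo (0 : ℝ) 1)] v n) ∧
      (∀ n, ∃ h : b n ∈ (Degenerate.friedrichs β).domain, Degenerate.friedrichs β ⟨b n, h⟩ = lam n • b n) ∧
      (∀ n, Degenerate.InDomain β (v n) ∧
        ∀ x ∈ Ioo (0 : ℝ) 1, Degenerate.diffExpr β (v n) x = lam n * v n x) ∧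
      (∀ i j,
        IntegrableOn (fun x => x ^ β * deriv (v i) x * deriv (v j) x) (Ioo 0 1) ∧
        ∫ x in Ioo (0 : ℝ) 1, x ^ β * deriv (v i) x * deriv (v j) x =
          if i = j then lam i else 0) := by
  have hK := KernelOperator.isHilbertSchmidt_operator Degenerate.measurable_green
    (Degenerate.memLp_greenMajorant hβ2) (Degenerate.ae_abs_green_le hβ1)
  obtain ⟨hdisc, b, lam, hpos, htop, hspec, hb, heig⟩ :=
    (Degenerate.isBoundedInverse_greenOperator hβ1 hβ2).hasDiscreteSpectrum
      Degenerate.not_finiteDimensional_L2 hK (Degenerate.isSymmetric_greenOperator hβ1 hβ2)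
      (LinearPMap.eq_zero_of_leftInverse Degenerate.dense_domain_operator
        (Degenerate.isSymmetric_greenOperator hβ1 hβ2) (Degenerate.greenOperator_operator hβ1 hβ2))
      (LinearPMap.inner_nonneg_of_rightInverse (Degenerate.operator_energy_nonneg β)
        (Degenerate.dense_greenOperator_mem_graph hβ1 hβ2))
  choose v hvc hbv hv using fun n => Degenerate.eigenfunction_regularity hβ0 hβ1 hβ2 (hb n)
  refine ⟨hdisc, lam, v, b, hpos, htop, hspec, hbv, heig,
    fun n => Degenerate.inDomain_of_eigen hβ1 hβ2 (hvc n) (hv n), fun i j => ?_⟩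
  -- With v i the solution for lam i * v i, Green's formula reduces the energy product to lam i
  -- times the L² product of v i and v j.
  have hE := Degenerate.integral_flux_mul_deriv hβ1 hβ2 (continuousOn_const.mul (hvc i))
    (continuousOn_const.mul (hvc j)) (f := fun x => lam i * v i x) (g := fun x => lam j * v j x)
  rw [← hv i, ← hv j] at hE
  refine ⟨hE.1, hE.2.trans ?_⟩
  have hinner : ∫ x in Ioo (0 : ℝ) 1, v i x * v j x = inner ℝ (b i) (b j) := by
    rw [L2.inner_def]
    refine integral_congr_ae ?_
    filter_upwards [hbv i, hbv j] with x h1 h2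
    rw [h1, h2]
    simp [mul_comm]
  simp only [mul_assoc]
  rw [integral_const_mul, hinner, orthonormal_iff_ite.1 b.orthonormal i j]
  split_ifs <;> simp
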